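/- For $r\ge 0$, a graph $H$ is an $r/2$-shallow topological minor of a graph $G$ if a graph obtained from $H$ by subdividing every edge at most $r$ times is isomorphic to a subgraph of $G$; in particular, $1$-shallow topological minors allow at most two subdivision vertices per edge. The problem Dense 1-Shallow Topological Minor has as input a finite simple graph $G$ and a rational number $d$, and asks whether $G$ has a $1$-shallow topological minor $H$ with at least one vertex and density $|E(H)|/|V(H)|\ge d$. The Exponential Time Hypothesis (ETH) states that there is a real $\delta>0$ such that no algorithm solves 3SAT with $v$ variables and $m$ clauses in time $2^{\delta v}(v+m)^{O(1)}$. Theorem. Unless ETH fails, there is no (deterministic) algorithm that decides Dense 1-Shallow Topological Minor in time $2^{o(t^2)}\,n^{O(1)}$, where $t$ is the treewidth of $G$ and $n$ is the size of the instance, that is, of the adjacency matrix of $G$ together with $d$ in binary (so that, in particular, no algorithm achieves time $2^{o(t^2)}|V(G)|^{O(1)}$). Explicitly: if ETH holds, then there are no algorithm, no function $f:\mathbb N\to\mathbb R$ with $f(t)=o(t^2)$ as $t\to\infty$, and no constants $K\in\mathbb R$, $c\in\mathbb N$ such that the algorithm decides every instance in at most $K\cdot 2^{f(t)}\cdot n^c$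 steps. -/

import Mathlib

open Filter Asymptotics

namespace DenseSTM

/-! ## Algorithms: the WHILE language over binary trees

Programs of the standard WHILE language (assignment, sequencing, conditional, loop) whose
variables hold binary trees. Every elementary operation (reading a variable, the constant `nil`,
`cons`, `hd`, `tl`, an assignment, a test) costs one time unit, as on a pointer machine in which
`cons` allocates one cell. This model simulates Turing machines and is simulated by them with
polynomial overhead, so that bounds such as `2^(o(k)) * poly` do not depend on the choice. -/

/-- The data on which programs operate. -/
inductive Data : Type
  | nil : Data
  | cons : Data → Data → Data

namespace Data

/-- The number of nodes of a tree. -/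
def size : Data → ℕ
  | nil => 1
  | cons a b => a.size + b.size + 1

/-- The first component (`nil` has components `nil`). -/
def hd : Data → Data
  | nil => nil
  | cons a _ => a

/-- The second component (`nil` has components `nil`). -/
def tl : Data → Data
  | nil => nil
  | cons _ b => b

/-- Truth values: `nil` is false, `cons nil nil` is true. -/
def ofBool : Bool → Data
  | false => nil
  | true => cons nil nil

/-- Lists, as right-nested pairs. -/
def ofList : List Data → Data
  | [] => nil
  | a :: l => cons a (ofList l)

/-- Natural numbers in unary. -/
def ofUnary : ℕ → Data
  | 0 => nil
  | n + 1 => cons nil (ofUnary n)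

/-- Natural numbers in binary, least significant digit first. -/
def ofBinary (n : ℕ) : Data :=
  ofList (n.bits.map ofBool)

/-- Rational numbers: sign, numerator and denominator in lowest terms, in binary. -/
def ofRat (d : ℚ) : Data :=
  cons (ofBool (decide (d < 0))) (cons (ofBinary d.num.natAbs) (ofBinary d.den))

end Data

/-- Expressions; variables are numbered. -/
inductive Expr : Type
  | var : ℕ → Expr
  | nil : Expr
  | cons : Expr → Expr → Expr
  | hd : Expr → Expr
  | tl : Expr → Expr

/-- A state assigns a value to every variable. -/
abbrev State : Type := ℕ → Data

namespace Expr

/-- The value of an expression. -/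
def eval (s : State) : Expr → Data
  | var x => s x
  | nil => Data.nil
  | cons a b => Data.cons (a.eval s) (b.eval s)
  | hd a => (a.eval s).hd
  | tl a => (a.eval s).tl

/-- The time for evaluating an expression: one unit per operation. -/
def cost : Expr → ℕ
  | var _ => 1
  | nil => 1
  | cons a b => a.cost + b.cost + 1
  | hd a => a.cost + 1
  | tl a => a.cost + 1

end Expr

/-- Programs. -/
inductive Prog : Type
  | assign : ℕ → Expr → Prog
  | seq : Prog → Prog → Prog
  | ite : Expr → Prog → Prog → Prog
  | loop : Expr → Prog → Prog

/-- `Exec p s s' t`: started in the state `s`, the program `p` halts after exactly `t` time units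
in the state `s'`. A test succeeds when the value of the expression is not `nil`. -/
inductive Exec : Prog → State → State → ℕ → Prop
  | assign (x : ℕ) (e : Expr) (s : State) :
      Exec (Prog.assign x e) s (Function.update s x (e.eval s)) (e.cost + 1)
  | seq {p q : Prog} {s₁ s₂ s₃ : State} {t₁ t₂ : ℕ} :
      Exec p s₁ s₂ t₁ → Exec q s₂ s₃ t₂ → Exec (Prog.seq p q) s₁ s₃ (t₁ + t₂)
  | ite_true {e : Expr} {p q : Prog} {s s' : State} {t : ℕ} :
      e.eval s ≠ Data.nil → Exec p s s' t → Exec (Prog.ite e p q) s s' (e.cost + 1 + t)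
  | ite_false {e : Expr} {p q : Prog} {s s' : State} {t : ℕ} :
      e.eval s = Data.nil → Exec q s s' t → Exec (Prog.ite e p q) s s' (e.cost + 1 + t)
  | loop_true {e : Expr} {p : Prog} {s₁ s₂ s₃ : State} {t₁ t₂ : ℕ} :
      e.eval s₁ ≠ Data.nil → Exec p s₁ s₂ t₁ → Exec (Prog.loop e p) s₂ s₃ t₂ →
      Exec (Prog.loop e p) s₁ s₃ (e.cost + 1 + t₁ + t₂)
  | loop_false {e : Expr} {p : Prog} {s : State} :
      e.eval s = Data.nil → Exec (Prog.loop e p) s s (e.cost + 1)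

/-- The initial state: the input is in variable `0`, all other variables hold `nil`. -/
def initState (x : Data) : State :=
  Function.update (fun _ => Data.nil) 0 x

/-- On input `x` the program `p` halts within `B` time units and answers the yes/no question `Q`
correctly; the answer is "yes" when variable `0` finally is not `nil`. -/
def AnswersWithin (p : Prog) (x : Data) (Q : Prop) (B : ℝ) : Prop :=
  ∃ (s : State) (t : ℕ), Exec p (initState x) s t ∧ (t : ℝ) ≤ B ∧ (s 0 ≠ Data.nil ↔ Q)

/-! ## 3SAT and the Exponential Time Hypothesis -/

/-- A CNF formula over the variables `x₀, …, xₙ₋₁`: a list of clauses, which are lists of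
literals; `(i, true)` is the literal `xᵢ` and `(i, false)` is its negation. -/
abbrev CNF (n : ℕ) : Type := List (List (Fin n × Bool))

namespace CNF

/-- Some assignment makes a literal true in every clause. -/
def Satisfiable {n : ℕ} (φ : CNF n) : Prop :=
  ∃ a : Fin n → Bool, ∀ C ∈ φ, ∃ l ∈ C, a l.1 = l.2

/-- Every clause has at most three literals. -/
def IsThreeCNF {n : ℕ} (φ : CNF n) : Prop :=
  ∀ C ∈ φ, C.length ≤ 3

/-- The encoding of a formula: the number of variables and the list of clauses (indices in unary,
which is polynomial in the numbers of variables and clauses for formulas with clauses of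
bounded size). -/
def encode {n : ℕ} (φ : CNF n) : Data :=
  Data.cons (Data.ofUnary n) (Data.ofList (φ.map fun C =>
    Data.ofList (C.map fun l => Data.cons (Data.ofUnary l.1) (Data.ofBool l.2))))

end CNF

/-- The Exponential Time Hypothesis: for some `δ > 0`, 3SAT with `n` variables and `m` clauses
cannot be solved in time `2^(δ n) (n + m)^O(1)`. -/
def ETH : Prop :=
  ∃ δ : ℝ, 0 < δ ∧ ¬ ∃ (p : Prog) (K : ℝ) (c : ℕ),
    ∀ (n : ℕ) (φ : CNF n), φ.IsThreeCNF →
      AnswersWithin p φ.encode φ.Satisfiable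
        (K * (2 : ℝ) ^ (δ * (n : ℝ)) * ((n : ℝ) + (φ.length : ℝ) + 1) ^ c)

/-! ## Treewidth -/

/-- A tree decomposition of `G`, indexed by the nodes of a finite tree. -/
structure TreeDecomposition {V : Type} (G : SimpleGraph V) (ι : Type) where
  /-- The tree. -/
  tree : SimpleGraph ι
  isTree : tree.IsTree
  /-- The bags. -/
  bag : ι → Set V
  exists_mem_bag : ∀ v, ∃ i, v ∈ bag i
  exists_edge_bag : ∀ u v, G.Adj u v → ∃ i, u ∈ bag i ∧ v ∈ bag i
  /-- The nodes whose bags contain a given vertex induce a subtree. -/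
  preconnected : ∀ v, (tree.induce {i | v ∈ bag i}).Preconnected

/-- The treewidth of a finite graph: the least `w` such that some tree decomposition has all its
bags of size at most `w + 1`. -/
noncomputable def treewidth {V : Type} [Finite V] (G : SimpleGraph V) : ℕ :=
  sInf {w : ℕ | ∃ (ι : Type) (_ : Finite ι) (D : TreeDecomposition G ι),
    ∀ i, (D.bag i).ncard ≤ w + 1}

/-! ## Dense shallow topological minors -/

/-- A model of `H` in `G` as an `r/2`-shallow topological minor, that is, a subgraph of `G` that
arises from `H` by subdividing every edge at most `r` times: the vertices of `H` are mapped
injectively to nails, and the edges of `H` to paths with at most `r` inner vertices that join the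
corresponding nails, contain no other nails, and are pairwise internally disjoint. -/
structure ShallowTopologicalModel {W V : Type} (r : ℕ) (H : SimpleGraph W) (G : SimpleGraph V) where
  /-- The nails. -/
  nail : W ↪ V
  /-- The path that replaces an edge. -/
  path : ∀ u v, H.Adj u v → G.Walk (nail u) (nail v)
  isPath : ∀ u v (h : H.Adj u v), (path u v h).IsPath
  length_le : ∀ u v (h : H.Adj u v), (path u v h).length ≤ r + 1
  /-- An edge is replaced by one path, whichever way it is traversed. -/
  symm : ∀ u v (h : H.Adj u v), path v u h.symm = (path u v h).reverse
  nail_mem : ∀ u v (h : H.Adj u v) (w : W), nail w ∈ (path u v h).support → w = u ∨ w = v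
  disjoint : ∀ u v (h : H.Adj u v) (u' v' : W) (h' : H.Adj u' v'), s(u, v) ≠ s(u', v') →
    ∀ x ∈ (path u v h).support, x ∈ (path u' v' h').support → x ∈ Set.range nail

/-- `H` is an `r/2`-shallow topological minor of `G`. -/
def IsHalfShallowTopologicalMinor {W V : Type} (r : ℕ) (H : SimpleGraph W) (G : SimpleGraph V) :
    Prop :=
  Nonempty (ShallowTopologicalModel r H G)

/-- The question of Dense `r/2`-Shallow Topological Minor on the instance `(G, d)`: is there an
`r/2`-shallow topological minor `H` of `G`, with at least one vertex, such that
`‖H‖ / |H| ≥ d`? -/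
def HasDenseHalfSTM {V : Type} (r : ℕ) (G : SimpleGraph V) (d : ℚ) : Prop :=
  ∃ (k : ℕ) (H : SimpleGraph (Fin k)), 0 < k ∧ IsHalfShallowTopologicalMinor r H G ∧
    d ≤ (H.edgeSet.ncard : ℚ) / (k : ℚ)

open Classical in
/-- The encoding of an instance `(G, d)`: the adjacency matrix of `G`, row by row, and `d`. -/
noncomputable def encodeInstance {n : ℕ} (G : SimpleGraph (Fin n)) (d : ℚ) : Data :=
  Data.cons
    (Data.ofList (List.ofFn fun i : Fin n =>
      Data.ofList (List.ofFn fun j : Fin n => Data.ofBool (decide (G.Adj i j)))))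
    (Data.ofRat d)

/-- The program `p` decides Dense 1-Shallow Topological Minor in time `2^(o(t²)) N^O(1)` on
instances of size `N` whose graph has treewidth `t`. -/
def DecidesDenseOneSTMSubexponentially (p : Prog) : Prop :=
  ∃ (f : ℕ → ℝ) (K : ℝ) (c : ℕ), f =o[atTop] (fun t : ℕ => (t : ℝ) ^ 2) ∧
    ∀ (n : ℕ) (G : SimpleGraph (Fin n)) (d : ℚ),
      AnswersWithin p (encodeInstance G d) (HasDenseHalfSTM 2 G d)
        (K * (2 : ℝ) ^ f (treewidth G) * ((encodeInstance G d).size : ℝ) ^ c)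

end DenseSTM

/-!
A polynomial-time reduction takes a 3CNF formula with `n` variables to an instance whose graph has
treewidth `t = O(√n)`. An algorithm running in time `2 ^ o(t ^ 2)` times a polynomial would thus
solve 3SAT in time `2 ^ o(n)` times a polynomial, against the Exponential Time Hypothesis
(`not_decides_of_eth`).

*Tight instances.* In a slot graph (`slotGraph`) every core vertex is adjacent to exactly its `D`
slots, every slot belongs to one core vertex, and slots have degree less than `D`. The density asked
for is `D / 2`, so all nails of a dense minor `H` are core vertices, all their degrees in `H` are
`D`, and every slot of a nail is used by an edge of `H`, that is, by a path of the form
core – slot – slot – core. A dense minor therefore is a perfect matching of the slots of a nonempty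
set of core vertices in which no two core vertices are connected by more than one matching edge
(`exists_matching_of_hasDenseHalfSTM`, `hasDenseHalfSTM_of_matching`).

*The layered graph.* The core vertices are arranged in `L` cyclically ordered layers, one for each
clause and some padding. A layer has `s = O(√n)` core vertices and one more, the hub, and the
variables of the formula are represented by pairs `(p, q)` of indices below `s`. For every layer `m`
and every pair there is a cycle of length four on slots of `(m, p)`, `(m + 1, q)`, `(m + 2, p)` and
`(m + 5, q)`. It can be matched in two ways, which stand for the values of a variable; the variable
is the one of `(p, q)` in the even layers and the one of `(q, p)` in the odd layers. Since the core
vertices `(m + 1, q)` and `(m + 2, p)` may be connected only once, the cycle of `(p, q)` in layer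
`m` and that of `(q, p)` in layer `m + 1` cannot both connect them, and this passes the values on
from layer to layer; around the cyclic order they agree.
For the clause of a layer there are `2 s` further slots with only `2 s - 1` partners at the hub, so
that one of them is matched along an edge that stands for a literal of the clause. That connects
`(m, p)`, or `(m + 2, p)` for a negative literal, with `(m + 5, q)`, and this connection is left
unused by the cycle of `(p, q)` exactly when the literal is true. This gives
`exists_consistent_of_hasDenseHalfSTM` and `hasDenseHalfSTM_of_consistent`.

*Treewidth.* The graph without the slots of the cycles has a path decomposition that sweeps through
the layers, with `O(s)` vertices in every bag. The cycles are added one at a time, which costs only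
four more vertices (`treewidth_le_of_iso_slotGraph`).

*Running time.* The reduction is a function on lists of numbers and truth values. The functions
computed by WHILE programs in polynomial time (`PolyTime`) are closed under composition, pairing,
case distinction and folding over lists with an accumulator of polynomial size, from which
`PolyTime.reduction` follows.
-/

namespace DenseSTM

/-! ### Polynomial-time functions on encoded types -/

/-- Types whose elements are represented as binary trees. -/
class Enc (α : Type) where
  /-- The representation. -/
  enc : α → Data

instance : Enc Unit := ⟨fun _ => Data.nil⟩
instance : Enc Bool := ⟨Data.ofBool⟩
instance : Enc ℕ := ⟨Data.ofUnary⟩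
instance {α β : Type} [Enc α] [Enc β] : Enc (α × β) :=
  ⟨fun x => Data.cons (Enc.enc x.1) (Enc.enc x.2)⟩
instance {α : Type} [Enc α] : Enc (List α) := ⟨fun l => Data.ofList (l.map Enc.enc)⟩

section Sizes

variable {α β γ : Type} [Enc α] [Enc β] [Enc γ]

/-- The size of the representation. -/
def esize (a : α) : ℕ := (Enc.enc a).size

theorem Data.one_le_size (d : Data) : 1 ≤ d.size := by
  cases d <;> simp [Data.size]

theorem one_le_esize (a : α) : 1 ≤ esize a := Data.one_le_size _

@[simp] theorem esize_pair (a : α) (b : β) : esize (a, b) = esize a + esize b + 1 := rfl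
@[simp] theorem esize_nil : esize ([] : List α) = 1 := rfl
@[simp] theorem esize_cons (a : α) (l : List α) : esize (a :: l) = esize a + esize l + 1 := rfl
@[simp] theorem esize_succ (n : ℕ) : esize (n + 1) = esize n + 2 := by
  change 1 + (Data.ofUnary n).size + 1 = (Data.ofUnary n).size + 2
  omega
theorem esize_nat (n : ℕ) : esize n = 2 * n + 1 := by
  induction n with
  | zero => rfl
  | succ n ih => rw [esize_succ, ih]; ring
theorem esize_bool_le (b : Bool) : esize b ≤ 3 := by
  cases b <;> simp [esize, Enc.enc, Data.ofBool, Data.size]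

theorem esize_append (l l' : List α) : esize (l ++ l') + 1 = esize l + esize l' := by
  induction l with
  | nil => simp; omega
  | cons a l ih => simp only [List.cons_append, esize_cons]; omega

theorem esize_le_of_mem {a : α} {l : List α} (h : a ∈ l) : esize a ≤ esize l := by
  induction l with
  | nil => simp at h
  | cons b l ih =>
    rcases List.mem_cons.1 h with rfl | h
    · simp only [esize_cons]; omega
    · have := ih h; simp only [esize_cons]; omega

theorem length_lt_esize (l : List α) : l.length < esize l := by
  induction l with
  | nil => simp
  | cons b l ih => simp only [esize_cons, List.length_cons]; omega

theorem esize_le_of_forall {l : List α} {B : ℕ} (h : ∀ a ∈ l, esize a ≤ B) :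
    esize l ≤ l.length * (B + 1) + 1 := by
  induction l with
  | nil => simp
  | cons b l ih =>
    have h1 := h b (by simp)
    have h2 := ih fun a ha => h a (by simp [ha])
    simp only [esize_cons, List.length_cons, Nat.succ_mul]; omega

/-- Functions bounded by a polynomial in the size of the argument. -/
def PolyBdd (g : α → ℕ) : Prop := ∃ c, ∀ a, g a ≤ (esize a + 1) ^ c

namespace PolyBdd

theorem mono {f g : α → ℕ} (hg : PolyBdd g) (h : ∀ a, f a ≤ g a) : PolyBdd f :=
  hg.imp fun _ hc a => (h a).trans (hc a)

theorem const (k : ℕ) : PolyBdd (fun _ : α => k) :=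
  ⟨k, fun a => k.lt_two_pow_self.le.trans
    (Nat.pow_le_pow_left (by have := one_le_esize a; omega) k)⟩

theorem size : PolyBdd (fun a : α => esize a) := ⟨1, fun a => by simp⟩

theorem mul {f g : α → ℕ} (hf : PolyBdd f) (hg : PolyBdd g) : PolyBdd (fun a => f a * g a) := by
  obtain ⟨c, hc⟩ := hf
  obtain ⟨d, hd⟩ := hg
  exact ⟨c + d, fun a => by rw [pow_add]; exact Nat.mul_le_mul (hc a) (hd a)⟩

theorem add {f g : α → ℕ} (hf : PolyBdd f) (hg : PolyBdd g) : PolyBdd (fun a => f a + g a) := by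
  obtain ⟨c, hc⟩ := hf
  obtain ⟨d, hd⟩ := hg
  refine ⟨max c d + 1, fun a => ?_⟩
  have h1 : 1 ≤ esize a + 1 := by omega
  have h2 := (hc a).trans (Nat.pow_le_pow_right h1 (le_max_left c d))
  have h3 := (hd a).trans (Nat.pow_le_pow_right h1 (le_max_right c d))
  have h4 := one_le_esize a
  rw [pow_succ]
  nlinarith

theorem pow {f : α → ℕ} (hf : PolyBdd f) (k : ℕ) : PolyBdd (fun a => f a ^ k) := by
  obtain ⟨c, hc⟩ := hf
  exact ⟨c * k, fun a => by rw [pow_mul]; exact Nat.pow_le_pow_left (hc a) k⟩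

theorem comp {g : β → ℕ} {f : α → β} (hg : PolyBdd g) (hf : PolyBdd fun a => esize (f a)) :
    PolyBdd (fun a => g (f a)) := by
  obtain ⟨c, hc⟩ := hg
  exact ((hf.add (const 1)).pow c).mono fun a => hc (f a)

end PolyBdd
end Sizes

/-! ### Programs and frames -/

/-- All variables of the expression are below `N`. -/
def Expr.VarsLt (N : ℕ) : Expr → Prop
  | var x => x < N
  | nil => True
  | cons a b => a.VarsLt N ∧ b.VarsLt N
  | hd a => a.VarsLt N
  | tl a => a.VarsLt N

/-- All variables of the program are below `N`. -/
def Prog.VarsLt (N : ℕ) : Prog → Prop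
  | assign x e => x < N ∧ e.VarsLt N
  | seq p q => p.VarsLt N ∧ q.VarsLt N
  | ite e p q => e.VarsLt N ∧ p.VarsLt N ∧ q.VarsLt N
  | loop e p => e.VarsLt N ∧ p.VarsLt N

theorem Expr.VarsLt.mono {N M : ℕ} (h : N ≤ M) {e : Expr} (he : e.VarsLt N) : e.VarsLt M := by
  induction e with
  | var x => exact lt_of_lt_of_le he h
  | nil => trivial
  | cons a b iha ihb => exact ⟨iha he.1, ihb he.2⟩
  | hd a ih => exact ih he
  | tl a ih => exact ih he

theorem Prog.VarsLt.mono {N M : ℕ} (h : N ≤ M) {p : Prog} (hp : p.VarsLt N) : p.VarsLt M := by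
  induction p with
  | assign x e => exact ⟨lt_of_lt_of_le hp.1 h, hp.2.mono h⟩
  | seq p q ihp ihq => exact ⟨ihp hp.1, ihq hp.2⟩
  | ite e p q ihp ihq => exact ⟨hp.1.mono h, ihp hp.2.1, ihq hp.2.2⟩
  | loop e p ih => exact ⟨hp.1.mono h, ih hp.2⟩

theorem Expr.VarsLt.eval_congr {N : ℕ} {e : Expr} (he : e.VarsLt N) {s r : State}
    (h : ∀ i < N, r i = s i) : e.eval r = e.eval s := by
  induction e with
  | var x => exact h x he
  | nil => rfl
  | cons a b iha ihb => simp only [Expr.eval, iha he.1, ihb he.2]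
  | hd a ih => simp only [Expr.eval, ih he]
  | tl a ih => simp only [Expr.eval, ih he]

/-- A program neither reads nor changes the variables that do not occur in it. -/
theorem Exec.frame {N : ℕ} {p : Prog} {s s' : State} {t : ℕ} (h : Exec p s s' t) :
    p.VarsLt N → ∀ r : State, (∀ i < N, r i = s i) →
      Exec p r (fun i => if i < N then s' i else r i) t := by
  have key : ∀ {s r : State}, (∀ i < N, r i = s i) → (fun i => if i < N then s i else r i) = r := by
    intro s r hr
    funext i
    by_cases hi : i < N
    · simp [hi, hr i hi]
    · simp [hi]
  have merge : ∀ (s₂ s₃ r : State), (fun i => if i < N then s₃ i else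
      (fun i => if i < N then s₂ i else r i) i) = fun i => if i < N then s₃ i else r i := by
    intro s₂ s₃ r
    funext i
    by_cases hi : i < N <;> simp [hi]
  induction h with
  | assign x e s =>
    intro hp r hr
    have : (fun i => if i < N then Function.update s x (e.eval s) i else r i) =
        Function.update r x (e.eval r) := by
      funext i
      rw [hp.2.eval_congr hr]
      by_cases hx : i = x
      · subst hx; simp [hp.1]
      · by_cases hi : i < N <;> simp [hx, hi, hr]
    rw [this]
    exact Exec.assign x e r
  | seq _ _ ih₁ ih₂ =>
    intro hp r hr
    have h2 := ih₂ hp.2 (fun i => if i < N then _ else r i) fun i hi => if_pos hi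
    rw [merge] at h2
    exact Exec.seq (ih₁ hp.1 r hr) h2
  | ite_true he _ ih =>
    intro hp r hr
    exact Exec.ite_true (by rwa [hp.1.eval_congr hr]) (ih hp.2.1 r hr)
  | ite_false he _ ih =>
    intro hp r hr
    exact Exec.ite_false (by rwa [hp.1.eval_congr hr]) (ih hp.2.2 r hr)
  | loop_true he _ _ ih₁ ih₂ =>
    intro hp r hr
    have h2 := ih₂ hp (fun i => if i < N then _ else r i) fun i hi => if_pos hi
    rw [merge] at h2
    exact Exec.loop_true (by rwa [hp.1.eval_congr hr]) (ih₁ hp.2 r hr) h2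
  | loop_false he =>
    intro hp r hr
    rw [key hr]
    exact Exec.loop_false (by rwa [hp.1.eval_congr hr])

/-- The state in which the variables `0`, `N` and `N + 1` hold `x`, `y` and `z`, and all other
variables hold `nil`. -/
def regs (N : ℕ) (x y z : Data) : State :=
  fun i => if i = 0 then x else if i = N then y else if i = N + 1 then z else Data.nil

theorem regs_nil (N : ℕ) (x : Data) : regs N x Data.nil Data.nil = initState x := by
  funext i
  by_cases hi : i = 0
  · subst hi; simp [regs, initState]
  · simp [regs, initState, hi]

section Regs

variable {N : ℕ} (x y z : Data)

theorem regs_zero : regs N x y z 0 = x := by simp [regs]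
theorem regs_fst (hN : 0 < N) : regs N x y z N = y := by simp [regs, hN.ne']
theorem regs_snd : regs N x y z (N + 1) = z := by simp [regs]

theorem Exec.regs_frame (hN : 0 < N) {p : Prog} {x x' : Data} {t : ℕ}
    (h : Exec p (initState x) (initState x') t) (hp : p.VarsLt N) :
    Exec p (regs N x y z) (regs N x' y z) t := by
  have h1 := h.frame hp (regs N x y z) fun i hi => by
    by_cases h0 : i = 0
    · subst h0; simp [regs, initState]
    · have h2 : i ≠ N := hi.ne
      have h3 : i ≠ N + 1 := by omega
      simp [regs, initState, h0, h2, h3]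
  convert h1 using 1
  funext i
  by_cases h0 : i = 0
  · subst h0; simp [regs, initState, hN]
  · by_cases hi : i < N
    · have h2 : i ≠ N := hi.ne
      have h3 : i ≠ N + 1 := by omega
      simp [regs, initState, h0, h2, h3, hi]
    · simp [regs, h0, hi]

theorem Exec.assign_zero (e : Expr) :
    Exec (Prog.assign 0 e) (regs N x y z) (regs N (e.eval (regs N x y z)) y z) (e.cost + 1) := by
  convert Exec.assign 0 e (regs N x y z) using 1
  funext i
  by_cases h0 : i = 0
  · subst h0; simp [regs]
  · simp [regs, h0]

theorem Exec.assign_fst (e : Expr) (hN : 0 < N) :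
    Exec (Prog.assign N e) (regs N x y z) (regs N x (e.eval (regs N x y z)) z) (e.cost + 1) := by
  convert Exec.assign N e (regs N x y z) using 1
  funext i
  by_cases h0 : i = 0
  · subst h0; simp [regs, hN.ne]
  · by_cases h1 : i = N
    · subst h1; simp [regs, h0]
    · simp [regs, h0, h1]

theorem Exec.assign_snd (e : Expr) :
    Exec (Prog.assign (N + 1) e) (regs N x y z) (regs N x y (e.eval (regs N x y z)))
      (e.cost + 1) := by
  convert Exec.assign (N + 1) e (regs N x y z) using 1
  funext i
  by_cases h0 : i = 0
  · subst h0; simp [regs]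
  · by_cases h1 : i = N + 1
    · subst h1; simp [regs]
    · simp [regs, h0, h1]

end Regs

/-! ### Combinators -/

/-- The function is computed in polynomial time by a program with the argument and the value in the
variable `0`, such that all other variables are `nil` at the beginning and at the end. The size
of the value has to be bounded too, as a tree built in `t` steps may have `2 ^ t` nodes. -/
def PolyTime {α β : Type} [Enc α] [Enc β] (f : α → β) : Prop :=
  PolyBdd (fun a => esize (f a)) ∧ ∃ (p : Prog) (N : ℕ) (T : α → ℕ), p.VarsLt N ∧ PolyBdd T ∧
    ∀ a, ∃ t ≤ T a, Exec p (initState (Enc.enc a)) (initState (Enc.enc (f a))) t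

namespace PolyTime

variable {α β γ δ : Type} [Enc α] [Enc β] [Enc γ] [Enc δ]

theorem of_expr {f : α → β} (hs : PolyBdd fun a => esize (f a)) (e : Expr) (he : e.VarsLt 1)
    (h : ∀ a, e.eval (initState (Enc.enc a)) = Enc.enc (f a)) : PolyTime f := by
  refine ⟨hs, Prog.assign 0 e, 1, fun _ => e.cost + 1, ⟨Nat.one_pos, he⟩, PolyBdd.const _,
    fun a => ⟨_, le_rfl, ?_⟩⟩
  have := Exec.assign_zero (N := 1) (Enc.enc a) Data.nil Data.nil e
  rwa [regs_nil, regs_nil, h] at this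

/-- Every tree is the value of an expression without variables. -/
theorem exists_expr (d : Data) : ∃ e : Expr, e.VarsLt 0 ∧ ∀ s, e.eval s = d := by
  induction d with
  | nil => exact ⟨Expr.nil, trivial, fun _ => rfl⟩
  | cons a b iha ihb =>
    obtain ⟨e, he, h⟩ := iha
    obtain ⟨e', he', h'⟩ := ihb
    exact ⟨Expr.cons e e', ⟨he, he'⟩, fun s => by rw [Expr.eval, h, h']⟩

theorem const (b : β) : PolyTime (fun _ : α => b) := by
  obtain ⟨e, he, h⟩ := exists_expr (Enc.enc b)
  exact of_expr (PolyBdd.const _) e (he.mono (Nat.zero_le _)) fun a => h _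

theorem fst_id : PolyTime (fun a : α × β => a.1) :=
  of_expr (PolyBdd.size.mono fun a => by rcases a with ⟨a, b⟩; simp only [esize_pair]; omega)
    (Expr.hd (Expr.var 0)) Nat.one_pos fun _ => rfl

theorem snd_id : PolyTime (fun a : α × β => a.2) :=
  of_expr (PolyBdd.size.mono fun a => by rcases a with ⟨a, b⟩; simp only [esize_pair]; omega)
    (Expr.tl (Expr.var 0)) Nat.one_pos fun _ => rfl

theorem comp {g : β → γ} {f : α → β} (hg : PolyTime g) (hf : PolyTime f) :
    PolyTime (fun a => g (f a)) := by
  obtain ⟨hfs, p, N, T, hp, hT, h⟩ := hf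
  obtain ⟨hgs, q, M, S, hq, hS, h'⟩ := hg
  refine ⟨hgs.comp hfs, Prog.seq p q, max N M, fun a => T a + S (f a),
    ⟨hp.mono (le_max_left _ _), hq.mono (le_max_right _ _)⟩, hT.add (hS.comp hfs), fun a => ?_⟩
  obtain ⟨t, ht, e⟩ := h a
  obtain ⟨t', ht', e'⟩ := h' (f a)
  exact ⟨t + t', Nat.add_le_add ht ht', Exec.seq e e'⟩

theorem fst {f : α → β × γ} (hf : PolyTime f) : PolyTime (fun a => (f a).1) := fst_id.comp hf
theorem snd {f : α → β × γ} (hf : PolyTime f) : PolyTime (fun a => (f a).2) := snd_id.comp hf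

theorem pair {f : α → β} {g : α → γ} (hf : PolyTime f) (hg : PolyTime g) :
    PolyTime (fun a => (f a, g a)) := by
  obtain ⟨hfs, p, N₁, T, hp, hT, h⟩ := hf
  obtain ⟨hgs, q, N₂, S, hq, hS, h'⟩ := hg
  set N := max N₁ N₂ + 1 with hN
  have hN0 : 0 < N := by omega
  refine ⟨(hfs.add hgs).add (PolyBdd.const 1) |>.mono fun a => by simp,
    Prog.seq (Prog.assign N (Expr.var 0)) (Prog.seq p
      (Prog.seq (Prog.assign (N + 1) (Expr.var 0)) (Prog.seq (Prog.assign 0 (Expr.var N))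
        (Prog.seq q (Prog.seq (Prog.assign 0 (Expr.cons (Expr.var (N + 1)) (Expr.var 0)))
          (Prog.seq (Prog.assign N Expr.nil) (Prog.assign (N + 1) Expr.nil))))))),
    N + 2, fun a => T a + S a + 14, ?_, (hT.add hS).add (PolyBdd.const _), fun a => ?_⟩
  · simp only [Prog.VarsLt, Expr.VarsLt]
    refine ⟨⟨by omega, by omega⟩, hp.mono (by omega), ⟨by omega, by omega⟩, ⟨by omega, by omega⟩,
      hq.mono (by omega), ⟨by omega, by omega, by omega⟩, ⟨by omega, trivial⟩, by omega, trivial⟩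
  · obtain ⟨t, ht, e⟩ := h a
    obtain ⟨t', ht', e'⟩ := h' a
    have e1 := Exec.assign_fst (N := N) (hN := hN0) (Enc.enc a) Data.nil Data.nil (Expr.var 0)
    have e2 := e.regs_frame (Enc.enc a) Data.nil hN0 (hp.mono (by omega))
    have e3 := Exec.assign_snd (N := N) (Enc.enc (f a)) (Enc.enc a) Data.nil (Expr.var 0)
    have e4 := Exec.assign_zero (N := N) (Enc.enc (f a)) (Enc.enc a) (Enc.enc (f a)) (Expr.var N)
    have e5 := e'.regs_frame (Enc.enc a) (Enc.enc (f a)) hN0 (hq.mono (by omega))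
    have e6 := Exec.assign_zero (N := N) (Enc.enc (g a)) (Enc.enc a) (Enc.enc (f a))
      (Expr.cons (Expr.var (N + 1)) (Expr.var 0))
    have e7 := Exec.assign_fst (N := N) (hN := hN0) (Data.cons (Enc.enc (f a)) (Enc.enc (g a)))
      (Enc.enc a) (Enc.enc (f a)) Expr.nil
    have e8 := Exec.assign_snd (N := N) (Data.cons (Enc.enc (f a)) (Enc.enc (g a))) Data.nil
      (Enc.enc (f a)) Expr.nil
    simp only [Expr.eval, Expr.cost, regs_zero, regs_fst (hN := hN0), regs_snd] at e1 e3 e4 e6 e7 e8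
    rw [regs_nil] at e1 e8
    exact ⟨_, by simp only; omega,
      e1.seq (e2.seq (e3.seq (e4.seq (e5.seq (e6.seq (e7.seq e8))))))⟩

theorem ite {b : α → Bool} {f g : α → β} (hb : PolyTime b) (hf : PolyTime f) (hg : PolyTime g) :
    PolyTime (fun a => if b a = true then f a else g a) := by
  obtain ⟨-, r, N₀, R, hr, hR, h₀⟩ := hb
  obtain ⟨hfs, p, N₁, T, hp, hT, h⟩ := hf
  obtain ⟨hgs, q, N₂, S, hq, hS, h'⟩ := hg
  set N := max N₀ (max N₁ N₂) + 1 with hN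
  have hN0 : 0 < N := by omega
  refine ⟨(hfs.add hgs).mono fun a => by dsimp only; split_ifs <;> omega,
    Prog.seq (Prog.assign N (Expr.var 0)) (Prog.seq r (Prog.ite (Expr.var 0)
      (Prog.seq (Prog.assign 0 (Expr.var N)) (Prog.seq (Prog.assign N Expr.nil) p))
      (Prog.seq (Prog.assign 0 (Expr.var N)) (Prog.seq (Prog.assign N Expr.nil) q)))),
    N + 1, fun a => R a + (T a + S a) + 8, ?_, (hR.add (hT.add hS)).add (PolyBdd.const _),
    fun a => ?_⟩
  · simp only [Prog.VarsLt, Expr.VarsLt]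
    refine ⟨⟨by omega, by omega⟩, hr.mono (by omega), by omega,
      ⟨⟨by omega, by omega⟩, ⟨by omega, trivial⟩, hp.mono (by omega)⟩,
      ⟨⟨by omega, by omega⟩, ⟨by omega, trivial⟩, hq.mono (by omega)⟩⟩
  · obtain ⟨u, hu, e₀⟩ := h₀ a
    obtain ⟨t, ht, e⟩ := h a
    obtain ⟨t', ht', e'⟩ := h' a
    have e1 := Exec.assign_fst (N := N) (hN := hN0) (Enc.enc a) Data.nil Data.nil (Expr.var 0)
    have e2 := e₀.regs_frame (Enc.enc a) Data.nil hN0 (hr.mono (by omega))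
    have e3 := Exec.assign_zero (N := N) (Enc.enc (b a)) (Enc.enc a) Data.nil (Expr.var N)
    have e4 := Exec.assign_fst (N := N) (hN := hN0) (Enc.enc a) (Enc.enc a) Data.nil Expr.nil
    simp only [Expr.eval, Expr.cost, regs_zero, regs_fst (hN := hN0)] at e1 e3 e4
    rw [regs_nil] at e1 e4
    cases hb : b a with
    | true =>
      rw [hb] at e2 e3
      have key := e1.seq (e2.seq (Exec.ite_true (e := Expr.var 0)
        (q := Prog.seq (Prog.assign 0 (Expr.var N)) (Prog.seq (Prog.assign N Expr.nil) q))
        (by simp [Expr.eval, regs, Enc.enc, Data.ofBool]) (e3.seq (e4.seq e))))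
      dsimp only
      rw [if_pos (show b a = true from hb)]
      exact ⟨_, by rw [Expr.cost]; omega, key⟩
    | false =>
      rw [hb] at e2 e3
      have key := e1.seq (e2.seq (Exec.ite_false (e := Expr.var 0)
        (p := Prog.seq (Prog.assign 0 (Expr.var N)) (Prog.seq (Prog.assign N Expr.nil) p))
        (by simp [Expr.eval, regs, Enc.enc, Data.ofBool]) (e3.seq (e4.seq e'))))
      dsimp only
      rw [if_neg (show ¬ b a = true by simp [hb])]
      exact ⟨_, by rw [Expr.cost]; omega, key⟩

/-- The loop that folds the step `p` over the list in the variable `N + 1`, with the context `x`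
in the variable `N` and the accumulator in the variable `0`. -/
theorem exec_fold {N : ℕ} (hN0 : 0 < N) {p : Prog} (hp : p.VarsLt N) (x : Data)
    (step : β → γ → β) (B : ℕ) (l : List γ) :
    ∀ b : β, (∀ l₁ c l₂, l = l₁ ++ c :: l₂ → ∃ t ≤ B,
      Exec p (initState (Data.cons x (Data.cons (Enc.enc (l₁.foldl step b)) (Enc.enc c))))
        (initState (Enc.enc (step (l₁.foldl step b) c))) t) →
    ∃ t ≤ (B + 20) * (l.length + 1),
      Exec (Prog.loop (Expr.var (N + 1)) (Prog.seq (Prog.assign 0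
          (Expr.cons (Expr.var N) (Expr.cons (Expr.var 0) (Expr.hd (Expr.var (N + 1))))))
        (Prog.seq (Prog.assign (N + 1) (Expr.tl (Expr.var (N + 1)))) p)))
        (regs N (Enc.enc b) x (Enc.enc l)) (regs N (Enc.enc (l.foldl step b)) x Data.nil) t := by
  induction l with
  | nil =>
    intro b _
    exact ⟨_, by simp [Expr.cost],
      Exec.loop_false (by simp [Expr.eval, regs, Enc.enc, Data.ofList])⟩
  | cons c l ih =>
    intro b h
    obtain ⟨t, ht, e⟩ := h [] c l rfl
    obtain ⟨t', ht', e'⟩ := ih (step b c) fun l₁ c' l₂ hl => by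
      simpa using h (c :: l₁) c' l₂ (by simp [hl])
    have e1 := Exec.assign_zero (N := N) (Enc.enc b) x (Enc.enc (c :: l))
      (Expr.cons (Expr.var N) (Expr.cons (Expr.var 0) (Expr.hd (Expr.var (N + 1)))))
    have e2 := Exec.assign_snd (N := N) (Data.cons x (Data.cons (Enc.enc b) (Enc.enc c))) x
      (Enc.enc (c :: l)) (Expr.tl (Expr.var (N + 1)))
    simp only [Expr.eval, Expr.cost, regs_zero, regs_fst (hN := hN0), regs_snd] at e1 e2
    have e3 := e.regs_frame x (Enc.enc l) hN0 hp
    refine ⟨_, ?_, Exec.loop_true ?_ (e1.seq (e2.seq e3)) e'⟩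
    · simp only [List.length_cons, Expr.cost]
      nlinarith
    · simp [Expr.eval, regs, Enc.enc, Data.ofList]

/-- Folding over a list, when the intermediate results have polynomial size. -/
theorem foldl {l : α → List γ} {b : α → β} {step : α → β → γ → β} (hl : PolyTime l)
    (hb : PolyTime b) (hstep : PolyTime fun y : α × β × γ => step y.1 y.2.1 y.2.2)
    {B : α → ℕ} (hB : PolyBdd B)
    (hacc : ∀ a l₁ l₂, l a = l₁ ++ l₂ → esize (l₁.foldl (step a) (b a)) ≤ B a) :
    PolyTime (fun a => (l a).foldl (step a) (b a)) := by
  obtain ⟨hls, p, N₀, T, hp, hT, h₀⟩ := hl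
  obtain ⟨hbs, q, N₁, S, hq, hS, h₁⟩ := hb
  obtain ⟨-, r, N₂, R, hr, ⟨k, hk⟩, h₂⟩ := hstep
  set N := max N₀ (max N₁ N₂) + 1 with hN
  have hN0 : 0 < N := by omega
  have hY : PolyBdd fun a => esize a + B a + esize (l a) + 2 :=
    ((PolyBdd.size.add hB).add hls).add (PolyBdd.const 2)
  refine ⟨hB.mono fun a => hacc a (l a) [] (by simp),
    Prog.seq (Prog.assign N (Expr.var 0)) (Prog.seq p (Prog.seq
      (Prog.assign (N + 1) (Expr.var 0)) (Prog.seq (Prog.assign 0 (Expr.var N)) (Prog.seq q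
      (Prog.seq (Prog.loop (Expr.var (N + 1)) (Prog.seq (Prog.assign 0
          (Expr.cons (Expr.var N) (Expr.cons (Expr.var 0) (Expr.hd (Expr.var (N + 1))))))
        (Prog.seq (Prog.assign (N + 1) (Expr.tl (Expr.var (N + 1)))) r)))
      (Prog.assign N Expr.nil)))))),
    N + 2, fun a => T a + S a + ((esize a + B a + esize (l a) + 2 + 1) ^ k + 20) * esize (l a) + 8,
    ?_, ((hT.add hS).add ((((hY.add (PolyBdd.const 1)).pow k).add (PolyBdd.const 20)).mul hls)).add
      (PolyBdd.const 8), fun a => ?_⟩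
  · simp only [Prog.VarsLt, Expr.VarsLt]
    refine ⟨⟨by omega, by omega⟩, hp.mono (by omega), ⟨by omega, by omega⟩, ⟨by omega, by omega⟩,
      hq.mono (by omega), ⟨by omega, ⟨by omega, by omega, by omega, by omega⟩,
      ⟨by omega, by omega⟩, hr.mono (by omega)⟩, by omega, trivial⟩
  · obtain ⟨t, ht, e⟩ := h₀ a
    obtain ⟨t', ht', e'⟩ := h₁ a
    have e1 := Exec.assign_fst (N := N) (hN := hN0) (Enc.enc a) Data.nil Data.nil (Expr.var 0)
    have e2 := e.regs_frame (Enc.enc a) Data.nil hN0 (hp.mono (by omega))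
    have e3 := Exec.assign_snd (N := N) (Enc.enc (l a)) (Enc.enc a) Data.nil (Expr.var 0)
    have e4 := Exec.assign_zero (N := N) (Enc.enc (l a)) (Enc.enc a) (Enc.enc (l a)) (Expr.var N)
    have e5 := e'.regs_frame (Enc.enc a) (Enc.enc (l a)) hN0 (hq.mono (by omega))
    obtain ⟨u, hu, e6⟩ := exec_fold hN0 (hr.mono (by omega)) (Enc.enc a) (step a)
      ((esize a + B a + esize (l a) + 2 + 1) ^ k) (l a) (b a) fun l₁ c l₂ hl => by
        obtain ⟨t, ht, e⟩ := h₂ (a, l₁.foldl (step a) (b a), c)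
        refine ⟨t, ht.trans ((hk _).trans (Nat.pow_le_pow_left ?_ k)), e⟩
        have h3 := hacc a l₁ (c :: l₂) hl
        have h4 : esize c ≤ esize (l a) := esize_le_of_mem (by simp [hl])
        simp only [esize_pair]
        omega
    have e7 := Exec.assign_fst (N := N) (hN := hN0) (Enc.enc ((l a).foldl (step a) (b a)))
      (Enc.enc a) Data.nil Expr.nil
    simp only [Expr.eval, Expr.cost, regs_zero, regs_fst (hN := hN0)] at e1 e3 e4 e7
    rw [regs_nil] at e1 e7
    refine ⟨_, ?_, e1.seq (e2.seq (e3.seq (e4.seq (e5.seq (e6.seq e7)))))⟩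
    have h5 := hu.trans (Nat.mul_le_mul_left _ (length_lt_esize (l a)))
    simp only
    omega

end PolyTime
/-! ### A library of polynomial-time functions -/

namespace PolyTime

variable {α β γ δ : Type} [Enc α] [Enc β] [Enc γ] [Enc δ]

/-- Functions whose values have the same representations are interchangeable. -/
theorem congr_enc {f : α → β} {g : α → γ} (hf : PolyTime f)
    (h : ∀ a, Enc.enc (g a) = Enc.enc (f a)) : PolyTime g := by
  have hs : ∀ a, esize (g a) = esize (f a) := fun a => congrArg Data.size (h a)
  obtain ⟨h1, p, N, T, hp, hT, h2⟩ := hf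
  exact ⟨h1.mono fun a => (hs a).le, p, N, T, hp, hT, fun a => by rw [h]; exact h2 a⟩

theorem congr {f g : α → β} (hf : PolyTime f) (h : ∀ a, g a = f a) : PolyTime g :=
  hf.congr_enc fun a => by rw [h]

theorem not {f : α → Bool} (hf : PolyTime f) : PolyTime (fun a => !f a) :=
  (hf.ite (const false) (const true)).congr fun a => by cases f a <;> rfl

theorem and {f g : α → Bool} (hf : PolyTime f) (hg : PolyTime g) :
    PolyTime (fun a => f a && g a) :=
  (hf.ite hg (const false)).congr fun a => by cases f a <;> rfl

theorem or {f g : α → Bool} (hf : PolyTime f) (hg : PolyTime g) :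
    PolyTime (fun a => f a || g a) :=
  (hf.ite (const true) hg).congr fun a => by cases f a <;> rfl

theorem boolEq {f g : α → Bool} (hf : PolyTime f) (hg : PolyTime g) :
    PolyTime (fun a => f a == g a) :=
  (hf.ite hg hg.not).congr fun a => by cases f a <;> cases g a <;> rfl

theorem cons {f : α → β} {l : α → List β} (hf : PolyTime f) (hl : PolyTime l) :
    PolyTime (fun a => f a :: l a) :=
  (hf.pair hl).congr_enc fun _ => rfl

theorem tail {l : α → List β} (hl : PolyTime l) : PolyTime (fun a => (l a).tail) :=
  (of_expr (f := fun l : List β => l.tail)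
    (PolyBdd.size.mono fun l => by
      cases l with
      | nil => exact le_rfl
      | cons b l => rw [List.tail_cons, esize_cons]; omega)
    (Expr.tl (Expr.var 0)) Nat.one_pos fun l => by cases l <;> rfl).comp hl

/-- The head of a list, when the default value is represented by `nil`. -/
theorem headD {l : α → List β} (hl : PolyTime l) {b : β} (hb : Enc.enc b = Data.nil) :
    PolyTime (fun a => (l a).headD b) :=
  (of_expr (f := fun l : List β => l.headD b)
    (PolyBdd.size.mono fun l => by
      cases l with
      | nil => simp only [List.headD_nil, esize, hb]; exact le_rfl
      | cons b l => rw [List.headD_cons, esize_cons]; omega)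
    (Expr.hd (Expr.var 0)) Nat.one_pos fun l => by
      cases l with
      | nil => exact hb.symm
      | cons => rfl).comp hl

theorem succ {f : α → ℕ} (hf : PolyTime f) : PolyTime (fun a => f a + 1) :=
  ((const ()).pair hf).congr_enc fun _ => rfl

theorem pred {f : α → ℕ} (hf : PolyTime f) : PolyTime (fun a => f a - 1) :=
  (of_expr (f := fun n : ℕ => n - 1)
    (PolyBdd.size.mono fun n => by rw [esize_nat, esize_nat]; omega)
    (Expr.tl (Expr.var 0)) Nat.one_pos fun n => by cases n <;> rfl).comp hf

theorem enc_replicate (n : ℕ) : Enc.enc (List.replicate n ()) = Enc.enc n := by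
  induction n with
  | zero => rfl
  | succ n ih => exact congrArg (Data.cons Data.nil) ih

theorem foldl_replicate {β : Type} (f : β → β) (n : ℕ) (b : β) :
    (List.replicate n ()).foldl (fun b _ => f b) b = f^[n] b := by
  induction n generalizing b with
  | zero => rfl
  | succ n ih => simp [List.replicate_succ, ih]

/-- Iterating a function, when the intermediate results have polynomial size. -/
theorem iterate {n : α → ℕ} {b : α → β} {f : α → β → β} (hn : PolyTime n) (hb : PolyTime b)
    (hf : PolyTime fun y : α × β => f y.1 y.2) {B : α → ℕ} (hB : PolyBdd B)
    (h : ∀ a, ∀ k ≤ n a, esize ((f a)^[k] (b a)) ≤ B a) :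
    PolyTime (fun a => (f a)^[n a] (b a)) := by
  refine (foldl (l := fun a => List.replicate (n a) ()) (step := fun a b _ => f a b)
    (hn.congr_enc fun a => enc_replicate _) hb
    (hf.comp (fst_id.pair snd_id.fst)) hB fun a l₁ l₂ hl => ?_).congr
    fun a => (foldl_replicate _ _ _).symm
  have h1 : l₁ = List.replicate l₁.length () :=
    List.eq_replicate_iff.2 ⟨rfl, fun _ _ => rfl⟩
  have h2 := congrArg List.length hl
  rw [List.length_replicate, List.length_append] at h2
  rw [h1, foldl_replicate]
  exact h a _ (by omega)

theorem add {f g : α → ℕ} (hf : PolyTime f) (hg : PolyTime g) : PolyTime (fun a => f a + g a) := by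
  have key : ∀ n k : ℕ, (fun x => x + 1)^[k] n = n + k := fun n k => by
    induction k with
    | zero => rfl
    | succ k ih => rw [Function.iterate_succ_apply', ih]; rfl
  refine (iterate (f := fun _ n => n + 1) hg hf snd_id.succ (hf.1.add hg.1) fun a k hk => ?_).congr
    fun a => (key _ _).symm
  simp only [key, esize_nat]
  omega

theorem sub {f g : α → ℕ} (hf : PolyTime f) (hg : PolyTime g) : PolyTime (fun a => f a - g a) := by
  have key : ∀ n k : ℕ, (fun x => x - 1)^[k] n = n - k := fun n k => by
    induction k with
    | zero => rfl
    | succ k ih => rw [Function.iterate_succ_apply', ih]; rfl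
  refine (iterate (f := fun _ n => n - 1) hg hf snd_id.pred hf.1 fun a k hk => ?_).congr
    fun a => (key _ _).symm
  simp only [key, esize_nat]
  omega

theorem mul {f g : α → ℕ} (hf : PolyTime f) (hg : PolyTime g) : PolyTime (fun a => f a * g a) := by
  have key : ∀ n k : ℕ, (fun x => x + n)^[k] 0 = n * k := fun n k => by
    induction k with
    | zero => rfl
    | succ k ih => rw [Function.iterate_succ_apply', ih]; rfl
  refine (iterate (f := fun a n => n + f a) hg (const 0) (snd_id.add (hf.comp fst_id))
    (hf.1.mul hg.1) fun a k hk => ?_).congr fun a => (key _ _).symm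
  simp only [key, esize_nat]
  nlinarith [Nat.mul_le_mul_left (f a) hk]

theorem pos {f : α → ℕ} (hf : PolyTime f) : PolyTime (fun a => decide (0 < f a)) := by
  have key : ∀ k : ℕ, (fun _ => true)^[k] false = decide (0 < k) := fun k => by
    cases k with
    | zero => rfl
    | succ k => rw [Function.iterate_succ_apply']; simp
  exact (iterate (f := fun _ _ => true) hf (const false) (const true) (PolyBdd.const 3)
    fun a k _ => esize_bool_le _).congr fun a => (key _).symm

theorem lt {f g : α → ℕ} (hf : PolyTime f) (hg : PolyTime g) :
    PolyTime (fun a => decide (f a < g a)) :=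
  (hg.sub hf).pos.congr fun a => by simp

theorem natEq {f g : α → ℕ} (hf : PolyTime f) (hg : PolyTime g) :
    PolyTime (fun a => f a == g a) :=
  ((hf.lt hg).not.and (hg.lt hf).not).congr fun a => by
    rw [Bool.eq_iff_iff]; simp; omega

theorem flatMap_esize {γ : Type} {l : List γ} {f : γ → List δ} {X : ℕ}
    (h : ∀ c ∈ l, esize (f c) ≤ X) :
    esize (l.flatMap f) ≤ l.length * X + 1 := by
  induction l with
  | nil => simp
  | cons c l ih =>
    have h1 := ih fun c hc => h c (by simp [hc])
    have h2 := h c (by simp)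
    have h3 := esize_append (f c) (l.flatMap f)
    rw [List.flatMap_cons, List.length_cons, Nat.succ_mul]
    omega

theorem foldl_cons {β : Type} (l l' : List β) :
    l.foldl (fun acc c => c :: acc) l' = l.reverse ++ l' := by
  induction l generalizing l' with
  | nil => simp
  | cons b l ih => simp [ih]

theorem esize_reverse (l : List β) : esize l.reverse = esize l := by
  induction l with
  | nil => rfl
  | cons b l ih =>
    have := esize_append l.reverse [b]
    rw [List.reverse_cons, esize_cons]
    rw [esize_cons, esize_nil] at this
    omega

theorem reverse {l : α → List β} (hl : PolyTime l) : PolyTime (fun a => (l a).reverse) := by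
  refine (foldl (step := fun _ acc c => c :: acc) hl (const []) (snd_id.snd.cons snd_id.fst) hl.1
    fun a l₁ l₂ h => ?_).congr fun a => by simp
  have := esize_append l₁ l₂
  have h2 := one_le_esize l₂
  rw [foldl_cons, List.append_nil, esize_reverse, h]
  omega

theorem append {l l' : α → List β} (hl : PolyTime l) (hl' : PolyTime l') :
    PolyTime (fun a => l a ++ l' a) := by
  refine (foldl (step := fun _ acc c => c :: acc) hl.reverse hl' (snd_id.snd.cons snd_id.fst)
    (hl.1.add hl'.1) fun a l₁ l₂ h => ?_).congr fun a => by simp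
  have h1 := esize_append l₁.reverse (l' a)
  have h2 := esize_append l₁ l₂
  have h3 := one_le_esize l₂
  rw [← h, esize_reverse] at h2
  rw [esize_reverse] at h1
  rw [foldl_cons]
  omega

theorem flatMap {l : α → List γ} {f : α → γ → List δ} (hl : PolyTime l)
    (hf : PolyTime fun y : α × γ => f y.1 y.2) : PolyTime (fun a => (l a).flatMap (f a)) := by
  have key : ∀ (g : γ → List δ) (l : List γ) (l' : List δ),
      l.foldl (fun acc c => acc ++ g c) l' = l' ++ l.flatMap g := by
    intro g l
    induction l with
    | nil => simp
    | cons b l ih => simp [ih]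
  obtain ⟨k, hk⟩ := hf.1
  refine (foldl (step := fun a acc c => acc ++ f a c) hl (const [])
    (snd_id.fst.append (hf.comp (fst_id.pair snd_id.snd)))
    (B := fun a => esize (l a) * (esize a + esize (l a) + 1 + 1) ^ k + 1)
    ((hl.1.mul (((PolyBdd.size.add hl.1).add (PolyBdd.const 1)).add (PolyBdd.const 1) |>.pow k)).add
      (PolyBdd.const 1)) fun a l₁ l₂ h => ?_).congr fun a => by simp [key]
  rw [key, List.nil_append]
  refine (flatMap_esize (X := (esize a + esize (l a) + 1 + 1) ^ k) fun c hc => ?_).trans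
    (Nat.add_le_add_right (Nat.mul_le_mul_right _ ?_) 1)
  · refine (hk (a, c)).trans (Nat.pow_le_pow_left ?_ k)
    have : esize c ≤ esize (l a) := esize_le_of_mem (by rw [h]; simp [hc])
    rw [esize_pair]
    omega
  · have := length_lt_esize (l a)
    rw [h, List.length_append] at this
    rw [h]
    omega

theorem map {l : α → List γ} {f : α → γ → δ} (hl : PolyTime l)
    (hf : PolyTime fun y : α × γ => f y.1 y.2) : PolyTime (fun a => (l a).map (f a)) :=
  (flatMap (f := fun a c => [f a c]) hl (hf.cons (const []))).congr fun a => by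
    induction l a with
    | nil => rfl
    | cons b l ih => simp [ih]

theorem any {l : α → List γ} {f : α → γ → Bool} (hl : PolyTime l)
    (hf : PolyTime fun y : α × γ => f y.1 y.2) : PolyTime (fun a => (l a).any (f a)) := by
  have key : ∀ (g : γ → Bool) (l : List γ) (b : Bool),
      l.foldl (fun acc c => acc || g c) b = (b || l.any g) := by
    intro g l
    induction l with
    | nil => simp
    | cons c l ih => intro b; simp [ih, Bool.or_assoc]
  exact (foldl (step := fun a acc c => acc || f a c) hl (const false)
    (snd_id.fst.or (hf.comp (fst_id.pair snd_id.snd))) (PolyBdd.const 3)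
    fun a l₁ l₂ _ => esize_bool_le _).congr fun a => by simp [key]

theorem length {l : α → List γ} (hl : PolyTime l) : PolyTime (fun a => (l a).length) := by
  have key : ∀ (l : List γ) (n : ℕ), l.foldl (fun acc _ => acc + 1) n = n + l.length := by
    intro l
    induction l with
    | nil => simp
    | cons c l ih => intro n; simp [ih]; omega
  refine (foldl (step := fun _ acc _ => acc + 1) hl (const 0) snd_id.fst.succ
    ((PolyBdd.const 2).mul hl.1) fun a l₁ l₂ h => ?_).congr fun a => by simp [key]
  have := length_lt_esize (l a)
  rw [h, List.length_append] at this
  rw [key, esize_nat, h]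
  omega

theorem range {n : α → ℕ} (hn : PolyTime n) : PolyTime (fun a => List.range (n a)) := by
  have key : ∀ k, (fun y : ℕ × List ℕ => (y.1 + 1, y.1 :: y.2))^[k] (0, []) =
      (k, (List.range k).reverse) := fun k => by
    induction k with
    | zero => rfl
    | succ k ih => simp [Function.iterate_succ_apply', ih, List.range_succ]
  have h := iterate (f := fun _ (y : ℕ × List ℕ) => (y.1 + 1, y.1 :: y.2)) hn
    (const (0, [])) (snd_id.fst.succ.pair (snd_id.fst.cons snd_id.snd))
    (B := fun a => esize (n a) * (esize (n a) + 1) + esize (n a) + 2)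
    (((hn.1.mul (hn.1.add (PolyBdd.const 1))).add hn.1).add (PolyBdd.const 2))
    fun a k hk => by
      rw [key, esize_pair]
      have h1 := esize_le_of_forall (l := (List.range k).reverse) (B := esize (n a)) fun x hx => by
        have : x < k := by simpa using hx
        rw [esize_nat, esize_nat]; omega
      rw [List.length_reverse, List.length_range] at h1
      have h2 : esize k ≤ esize (n a) := by rw [esize_nat, esize_nat]; omega
      have h3 : k * (esize (n a) + 1) ≤ esize (n a) * (esize (n a) + 1) :=
        Nat.mul_le_mul_right _ (by rw [esize_nat]; omega)
      omega
  exact h.snd.reverse.congr fun a => by simp [key]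

/-- Reading a list at a position, when the default value is represented by `nil`. -/
theorem getD {l : α → List β} {n : α → ℕ} (hl : PolyTime l) (hn : PolyTime n) {b : β}
    (hb : Enc.enc b = Data.nil) : PolyTime (fun a => (l a).getD (n a) b) := by
  have key : ∀ (k : ℕ) (l : List β), List.tail^[k] l = l.drop k := fun k l => by
    induction k with
    | zero => rfl
    | succ k ih => rw [Function.iterate_succ_apply', ih, List.tail_drop]
  have hd : ∀ (k : ℕ) (l : List β), esize (l.drop k) ≤ esize l := fun k l => by
    have h1 := esize_append (l.take k) (l.drop k)
    have h2 := one_le_esize (l.take k)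
    rw [List.take_append_drop] at h1
    omega
  refine ((iterate (f := fun _ l => List.tail l) hn hl snd_id.tail hl.1
    fun a k _ => by rw [key]; exact hd _ _).headD hb).congr fun a => ?_
  rw [key, List.headD_eq_head?_getD, List.head?_drop, List.getD_eq_getElem?_getD]

end PolyTime
/-! ### The reduction as a function on lists -/

/-- `(s, b)`, where `s` is a power of two with `n ≤ s ^ 2 ≤ 4 * n + 4` and `b` is the list of the
binary digits of `s / 2`. -/
def scale (n : ℕ) : ℕ × List Bool :=
  (fun y : ℕ × List Bool =>
    if decide (y.1 * y.1 < n) = true then (y.1 + y.1, false :: y.2) else y)^[n] (2, [true])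

theorem scale_iterate (n k : ℕ) : ∃ e : ℕ,
    (fun y : ℕ × List Bool =>
      if decide (y.1 * y.1 < n) = true then (y.1 + y.1, false :: y.2) else y)^[k] (2, [true]) =
      (2 * 2 ^ e, (2 ^ e).bits) ∧ (2 * 2 ^ e) * (2 * 2 ^ e) ≤ 4 * n + 4 ∧
      (n ≤ (2 * 2 ^ e) * (2 * 2 ^ e) ∨ k + 2 ≤ 2 * 2 ^ e) := by
  induction k with
  | zero => exact ⟨0, by simp, by simp, by simp⟩
  | succ k ih =>
    obtain ⟨e, h1, h2, h3⟩ := ih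
    rw [Function.iterate_succ_apply', h1]
    by_cases h : (2 * 2 ^ e) * (2 * 2 ^ e) < n
    · refine ⟨e + 1, ?_, ?_, Or.inr ?_⟩
      · have hb : (2 * 2 ^ e).bits = false :: (2 ^ e).bits := Nat.bit0_bits _ (by positivity)
        simp only [h, decide_true, if_true, pow_succ']
        rw [hb, two_mul (2 * 2 ^ e)]
      · rw [pow_succ']; nlinarith
      · rw [pow_succ']
        have := Nat.one_le_two_pow (n := e)
        rcases h3 with h3 | h3 <;> omega
    · exact ⟨e, by simp [h], h2, Or.inl (not_lt.1 h)⟩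

theorem scale_spec (n : ℕ) : ∃ e : ℕ, scale n = (2 * 2 ^ e, (2 ^ e).bits) ∧
    (2 * 2 ^ e) * (2 * 2 ^ e) ≤ 4 * n + 4 ∧ n ≤ (2 * 2 ^ e) * (2 * 2 ^ e) := by
  obtain ⟨e, h1, h2, h3⟩ := scale_iterate n n
  refine ⟨e, h1, h2, h3.elim _root_.id fun h => ?_⟩
  nlinarith

theorem length_bits_two_pow (e : ℕ) : (2 ^ e).bits.length = e + 1 := by
  induction e with
  | zero => simp
  | succ e ih => rw [pow_succ', Nat.bit0_bits _ (by positivity), List.length_cons, ih]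

theorem PolyTime.scale {α : Type} [Enc α] {n : α → ℕ} (hn : PolyTime n) :
    PolyTime (fun a => scale (n a)) := by
  refine PolyTime.iterate
    (f := fun a (y : ℕ × List Bool) =>
      if decide (y.1 * y.1 < n a) = true then (y.1 + y.1, false :: y.2) else y)
    (b := fun _ => (2, [true])) hn (const _) ?_ (B := fun a => 100 * esize (n a) + 100)
    (((PolyBdd.const 100).mul hn.1).add (PolyBdd.const 100)) fun a k _ => ?_
  · exact PolyTime.ite ((snd_id.fst.mul snd_id.fst).lt (hn.comp fst_id))
      ((snd_id.fst.add snd_id.fst).pair ((const false).cons snd_id.snd)) snd_id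
  · obtain ⟨e, h1, h2, -⟩ := scale_iterate (n a) k
    rw [h1, esize_pair, esize_nat, esize_nat]
    have h3 := esize_le_of_forall (l := (2 ^ e).bits) (B := 3) fun b _ => esize_bool_le b
    rw [length_bits_two_pow] at h3
    have h4 : e < 2 ^ e := e.lt_two_pow_self
    nlinarith

/-- Vertices are quadruples `(m, i, r, j)`. Those with `r = 4` and `j = 0` are core vertices; the
core vertex `(m, i)` owns the slots `(m, i, r, j)` with `r < 4`. The indices `i` and `j` are at
most `s`, and `s` plays the role of `none`. -/
abbrev Label : Type := ℕ × ℕ × ℕ × ℕ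

/-- Advancing from the layer of `a` by `d`, modulo `L`, leads to the layer of `b`, and the slots
have the roles `r` and `r'`. -/
def link (L d r r' : ℕ) (a b : Label) : Bool :=
  (a.2.2.1 == r && b.2.2.1 == r') && ((a.1 + d == b.1) || (a.1 + d == b.1 + L))

/-- The clause contains the literal `(x, b)`. -/
def hasLit (C : List (ℕ × Bool)) (x : ℕ) (b : Bool) : Bool :=
  C.any fun l => l.1 == x && l.2 == b

/-- A slot and the core vertex that owns it. -/
def ownerArc (a b : Label) : Bool :=
  decide (a.2.2.1 < 4) && (b.2.2.1 == 4) && (a.1 == b.1) && (a.2.1 == b.2.1)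

/-- The edges of the cycles of length four that carry the values of the variables. -/
def cycleArc (s L : ℕ) (a b : Label) : Bool :=
  (decide (a.2.1 < s) && decide (a.2.2.2 < s) && (a.2.2.2 == b.2.1) && (a.2.1 == b.2.2.2)) &&
    (link L 1 0 1 a b || link L 1 1 2 a b || link L 3 2 3 a b || link L 5 0 3 a b)

/-- The edges between slots of the vertices `(m, s)` and slots of vertices `(m, i)`, `i < s`. -/
def hubArc (s L : ℕ) (a b : Label) : Bool :=
  ((a.2.1 == s) && decide (b.2.1 < s) && decide (a.2.2.2 < s) && (b.2.2.2 == s)) &&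
    ((link L 0 0 0 a b && decide (0 < a.2.2.2) && ((b.2.1 == a.2.2.2) || (b.2.1 == 0))) ||
      (link L 2 1 1 a b && (b.2.1 == a.2.2.2)) || (link L 0 1 0 a b && (b.2.1 == 0)) ||
      (link L 5 2 2 a b && decide (0 < a.2.2.2) && ((b.2.1 == a.2.2.2) || (b.2.1 == 0))) ||
      (link L 1 3 3 a b && (b.2.1 == a.2.2.2)))

/-- The edges between slots of vertices `(m, s)`. -/
def hubHubArc (s L : ℕ) (a b : Label) : Bool :=
  ((a.2.1 == s) && (b.2.1 == s)) &&
    ((link L 3 0 2 a b && (a.2.2.2 == 0) && (b.2.2.2 == 0)) ||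
      ((a.2.2.2 == s) && (b.2.2.2 == s) && (link L 1 0 1 a b || link L 2 2 3 a b)))

/-- The edges for the literals of the clauses. The clause of the layer two before the layer `m` is
found by reading the doubled list at `m + (L - 2)`. -/
def literalArc (s L : ℕ) (cl : List (List (ℕ × Bool))) (a b : Label) : Bool :=
  (decide (a.2.1 < s) && decide (b.2.1 < s) && (a.2.2.2 == s) && (b.2.2.2 == s)) &&
    ((link L 5 0 2 a b && hasLit (cl.getD a.1 []) (a.2.1 * s + b.2.1) true) ||
      (link L 3 1 2 a b && hasLit ((cl ++ cl).getD (a.1 + (L - 2)) []) (a.2.1 * s + b.2.1) false))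

/-- The directed edges of the graph. -/
def arc (s L : ℕ) (cl : List (List (ℕ × Bool))) (a b : Label) : Bool :=
  ownerArc a b || cycleArc s L a b || hubArc s L a b || hubHubArc s L a b || literalArc s L cl a b

/-- The list of the vertices. -/
def labels (s L : ℕ) : List Label :=
  (List.range L).flatMap fun m => (List.range (s + 1)).flatMap fun i =>
    (m, i, 4, 0) :: (List.range 4).flatMap fun r => (List.range (s + 1)).map fun j => (m, i, r, j)

/-- One clause per layer: the clauses of the formula in the even layers, and in the remaining
layers the tautology `x₀ ∨ ¬ x₀`. The number of layers is even and at least twelve. -/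
def layerClauses (cls : List (List (ℕ × Bool))) : List (List (ℕ × Bool)) :=
  (cls.flatMap fun C => [C, [(0, true), (0, false)]]) ++
    List.replicate 12 [(0, true), (0, false)]

/-- The adjacency matrix of the constructed graph. -/
def matrix (s L : ℕ) (cl : List (List (ℕ × Bool))) : List (List Bool) :=
  (labels s L).map fun a => (labels s L).map fun b => arc s L cl a b || arc s L cl b a

/-- The instance constructed from a formula with `x.1` variables and the clauses `x.2`. -/
def reduction (x : ℕ × List (List (ℕ × Bool))) :
    List (List Bool) × Bool × List Bool × List Bool :=
  (matrix (scale x.1).1 (layerClauses x.2).length (layerClauses x.2),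
    false, false :: true :: (scale x.1).2, [true])

namespace PolyTime

variable {α : Type} [Enc α] {s L : α → ℕ} {cl : α → List (List (ℕ × Bool))} {a b : α → Label}

theorem link (hL : PolyTime L) (ha : PolyTime a) (hb : PolyTime b) (d r r' : ℕ) :
    PolyTime (fun x => link (L x) d r r' (a x) (b x)) := by
  unfold DenseSTM.link
  exact ((ha.snd.snd.fst.natEq (const r)).and (hb.snd.snd.fst.natEq (const r'))).and
    (((ha.fst.add (const d)).natEq hb.fst).or ((ha.fst.add (const d)).natEq (hb.fst.add hL)))

theorem hasLit {C : α → List (ℕ × Bool)} {x : α → ℕ} (hC : PolyTime C) (hx : PolyTime x)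
    (v : Bool) : PolyTime (fun y => hasLit (C y) (x y) v) := by
  unfold DenseSTM.hasLit
  exact any hC ((snd_id.fst.natEq (hx.comp fst_id)).and (snd_id.snd.boolEq (const v)))

theorem arc (hs : PolyTime s) (hL : PolyTime L) (hcl : PolyTime cl) (ha : PolyTime a)
    (hb : PolyTime b) : PolyTime (fun x => arc (s x) (L x) (cl x) (a x) (b x)) := by
  have ha1 := ha.snd.fst
  have ha2 := ha.snd.snd.snd
  have hb1 := hb.snd.fst
  have hb2 := hb.snd.snd.snd
  unfold DenseSTM.arc ownerArc cycleArc hubArc hubHubArc literalArc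
  have hl := link hL ha hb
  refine ((((?_ : PolyTime _).or ?_).or ?_).or ?_).or ?_
  · exact (((ha.snd.snd.fst.lt (const 4)).and (hb.snd.snd.fst.natEq (const 4))).and
      (ha.fst.natEq hb.fst)).and (ha1.natEq hb1)
  · exact ((((ha1.lt hs).and (ha2.lt hs)).and (ha2.natEq hb1)).and (ha1.natEq hb2)).and
      ((((hl 1 0 1).or (hl 1 1 2)).or (hl 3 2 3)).or (hl 5 0 3))
  · have h0 := ((const 0).lt ha2)
    have h1 := hb1.natEq ha2
    have h2 := hb1.natEq (const 0)
    exact ((((ha1.natEq hs).and (hb1.lt hs)).and (ha2.lt hs)).and (hb2.natEq hs)).and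
      ((((((((hl 0 0 0).and h0).and (h1.or h2)).or ((hl 2 1 1).and h1)).or ((hl 0 1 0).and h2))).or
        (((hl 5 2 2).and h0).and (h1.or h2))).or ((hl 1 3 3).and h1))
  · exact ((ha1.natEq hs).and (hb1.natEq hs)).and
      ((((hl 3 0 2).and (ha2.natEq (const 0))).and (hb2.natEq (const 0))).or
        (((ha2.natEq hs).and (hb2.natEq hs)).and ((hl 1 0 1).or (hl 2 2 3))))
  · have hv := (ha1.mul hs).add hb1
    exact ((((ha1.lt hs).and (hb1.lt hs)).and (ha2.natEq hs)).and (hb2.natEq hs)).and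
      (((hl 5 0 2).and (hasLit (hcl.getD ha.fst rfl) hv true)).or
        ((hl 3 1 2).and (hasLit ((hcl.append hcl).getD (ha.fst.add (hL.sub (const 2))) rfl)
          hv false)))

theorem labels (hs : PolyTime s) (hL : PolyTime L) :
    PolyTime (fun x => labels (s x) (L x)) := by
  unfold DenseSTM.labels
  refine flatMap hL.range (flatMap (hs.comp fst_id).succ.range
    (cons (fst_id.snd.pair (snd_id.pair (const (4, 0)))) (flatMap (const (List.range 4))
      (map (hs.comp fst_id.fst.fst).succ.range ?_))))
  exact fst_id.fst.fst.snd.pair (fst_id.fst.snd.pair (fst_id.snd.pair snd_id))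

theorem layerClauses (hcl : PolyTime cl) : PolyTime (fun x => layerClauses (cl x)) := by
  unfold DenseSTM.layerClauses
  exact (flatMap hcl (snd_id.cons (const _))).append (const _)

theorem matrix (hs : PolyTime s) (hL : PolyTime L) (hcl : PolyTime cl) :
    PolyTime (fun x => matrix (s x) (L x) (cl x)) := by
  unfold DenseSTM.matrix
  refine map (labels hs hL) (map (labels (hs.comp fst_id) (hL.comp fst_id)) ?_)
  have ha : PolyTime fun y : (α × Label) × Label => y.1.2 := fst_id.snd
  have hb : PolyTime fun y : (α × Label) × Label => y.2 := snd_id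
  have hs' : PolyTime fun y : (α × Label) × Label => s y.1.1 := hs.comp fst_id.fst
  have hL' : PolyTime fun y : (α × Label) × Label => L y.1.1 := hL.comp fst_id.fst
  have hcl' : PolyTime fun y : (α × Label) × Label => cl y.1.1 := hcl.comp fst_id.fst
  exact (arc hs' hL' hcl' ha hb).or (arc hs' hL' hcl' hb ha)

theorem reduction : PolyTime DenseSTM.reduction := by
  unfold DenseSTM.reduction
  have hs := scale (n := fun x : ℕ × List (List (ℕ × Bool)) => x.1) fst_id
  have hcl := layerClauses (cl := fun x : ℕ × List (List (ℕ × Bool)) => x.2) snd_id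
  exact (matrix hs.fst hcl.length hcl).pair
    ((const false).pair (((const false).cons ((const true).cons hs.snd)).pair (const [true])))

end PolyTime
/-! ### Dense minors of slot graphs -/

section SlotGraph

variable {C U : Type}

/-- The graph in which every core vertex `c` is joined to its slots, the elements of `U` that are
mapped to `c` by `o`, and in which the slots are joined as in `F`. -/
def slotGraph (o : U → C) (F : SimpleGraph U) : SimpleGraph (C ⊕ U) where
  Adj
    | .inl _, .inl _ => False
    | .inl c, .inr u => o u = c
    | .inr u, .inl c => o u = c
    | .inr u, .inr u' => F.Adj u u'
  symm := by
    constructor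
    rintro (c | u) (c' | u') h
    · exact h
    · exact h
    · exact h
    · exact SimpleGraph.Adj.symm (G := F) h
  loopless := by
    constructor
    rintro (c | u) h
    · exact h
    · exact F.irrefl h

variable {o : U → C} {F : SimpleGraph U}

@[simp] theorem slotGraph_inl_inl (c c' : C) : ¬ (slotGraph o F).Adj (.inl c) (.inl c') :=
  fun h => h
@[simp] theorem slotGraph_inl_inr (c : C) (u : U) :
    (slotGraph o F).Adj (.inl c) (.inr u) ↔ o u = c := Iff.rfl
@[simp] theorem slotGraph_inr_inl (c : C) (u : U) :
    (slotGraph o F).Adj (.inr u) (.inl c) ↔ o u = c := Iff.rfl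
@[simp] theorem slotGraph_inr_inr (u u' : U) :
    (slotGraph o F).Adj (.inr u) (.inr u') ↔ F.Adj u u' := Iff.rfl

/-- A dense minor may be given on any finite vertex type. -/
theorem HasDenseHalfSTM.of_model {V W : Type} [Fintype W] [Nonempty W] {r : ℕ}
    {G : SimpleGraph V} {H : SimpleGraph W} (m : ShallowTopologicalModel r H G) {d : ℚ}
    (hd : d ≤ (H.edgeSet.ncard : ℚ) / (Fintype.card W : ℚ)) : HasDenseHalfSTM r G d := by
  classical
  let e : Fin (Fintype.card W) ≃ W := (Fintype.equivFin W).symm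
  refine ⟨Fintype.card W, H.comap e, Fintype.card_pos, ⟨?_⟩, ?_⟩
  · exact
    { nail := e.toEmbedding.trans m.nail
      path := fun u v h => m.path (e u) (e v) h
      isPath := fun u v h => m.isPath _ _ h
      length_le := fun u v h => m.length_le _ _ h
      symm := fun u v h => m.symm _ _ h
      nail_mem := fun u v h w hw => (m.nail_mem _ _ h (e w) hw).imp (e.injective ·) (e.injective ·)
      disjoint := fun u v h u' v' h' hne x hx hx' => by
        obtain ⟨w, rfl⟩ := m.disjoint (e u) (e v) h (e u') (e v') h' (fun heq => hne (by
          apply Sym2.map.injective e.injective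
          simpa using heq)) x hx hx'
        exact ⟨e.symm w, by simp⟩ }
  · have h1 : (H.comap e).edgeSet.ncard = H.edgeSet.ncard :=
      Nat.card_congr (SimpleGraph.Iso.mapEdgeSet (SimpleGraph.Iso.comap e H))
    rwa [h1]

theorem HasDenseHalfSTM.of_iso {V V' : Type} {r : ℕ} {G : SimpleGraph V} {G' : SimpleGraph V'}
    (f : G ≃g G') {d : ℚ} (h : HasDenseHalfSTM r G d) : HasDenseHalfSTM r G' d := by
  obtain ⟨k, H, hk, ⟨m⟩, hd⟩ := h
  refine ⟨k, H, hk, ⟨?_⟩, hd⟩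
  have hmem : ∀ {a b : V} (p : G.Walk a b) (x : V), f x ∈ (p.map f.toHom).support ↔
      x ∈ p.support := fun p x => by
    rw [SimpleGraph.Walk.support_map]
    exact List.mem_map_of_injective f.injective
  exact
    { nail := m.nail.trans f.toEquiv.toEmbedding
      path := fun u v h => (m.path u v h).map f.toHom
      isPath := fun u v h => (m.isPath u v h).map f.injective
      length_le := fun u v h =>
        (SimpleGraph.Walk.length_map f.toHom (m.path u v h)).trans_le (m.length_le u v h)
      symm := fun u v h => (congrArg (SimpleGraph.Walk.map f.toHom) (m.symm u v h)).trans
        (SimpleGraph.Walk.reverse_map f.toHom (m.path u v h)).symm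
      nail_mem := fun u v h w hw => m.nail_mem u v h w ((hmem _ _).1 hw)
      disjoint := fun u v h u' v' h' hne x hx hx' => by
        obtain ⟨x, rfl⟩ := f.surjective x
        obtain ⟨w, hw⟩ := m.disjoint u v h u' v' h' hne x ((hmem _ _).1 hx) ((hmem _ _).1 hx')
        exact ⟨w, congrArg f hw⟩ }

/-- A perfect matching of the slots that joins slots of different core vertices and
each pair of core vertices at most once yields a dense minor on all core vertices: its edges are
the paths from a core vertex through two matched slots to another core vertex. -/
theorem hasDenseHalfSTM_of_matching [Fintype C] [Nonempty C] [Fintype U] {D : ℕ}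
    (hD : ∀ c, Nat.card {u // o u = c} = D) (M : U → U) (hF : ∀ u, F.Adj u (M u))
    (hM : ∀ u, M (M u) = u) (hne : ∀ u, o u ≠ o (M u))
    (huniq : ∀ u u', o u = o u' → o (M u) = o (M u') → u = u') :
    HasDenseHalfSTM 2 (slotGraph o F) ((D : ℚ) / 2) := by
  classical
  let H : SimpleGraph C :=
    { Adj := fun c c' => ∃ u, o u = c ∧ o (M u) = c'
      symm := by
        constructor
        rintro c c' ⟨u, h1, h2⟩
        exact ⟨M u, h2, by rw [hM, h1]⟩
      loopless := by
        constructor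
        rintro c ⟨u, h1, h2⟩
        exact hne u (h1.trans h2.symm) }
  choose mid hmid1 hmid2 using fun (c c' : C) (h : H.Adj c c') => h
  let G := slotGraph o F
  let P : ∀ c c', H.Adj c c' → G.Walk (.inl c) (.inl c') := fun c c' h =>
    .cons (show G.Adj (.inl c) (.inr (mid c c' h)) from hmid1 c c' h) <|
    .cons (show G.Adj (.inr (mid c c' h)) (.inr (M (mid c c' h))) from hF _) <|
    .cons (show G.Adj (.inr (M (mid c c' h))) (.inl c') from hmid2 c c' h) .nil
  have hsupp : ∀ c c' h, (P c c' h).support =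
      [.inl c, .inr (mid c c' h), .inr (M (mid c c' h)), .inl c'] := fun c c' h => rfl
  have hrev : ∀ c c' (h : H.Adj c c'), mid c' c h.symm = M (mid c c' h) := fun c c' h =>
    huniq _ _ ((hmid1 _ _ _).trans (hmid2 _ _ _).symm) (by rw [hM, hmid1, hmid2])
  have model : ShallowTopologicalModel 2 H G :=
    { nail := ⟨Sum.inl, Sum.inl_injective⟩
      path := P
      isPath := fun c c' h => by
        rw [SimpleGraph.Walk.isPath_def, hsupp]
        have h1 : c ≠ c' := h.ne
        have h2 : mid c c' h ≠ M (mid c c' h) := (hF _).ne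
        simp [h1, h2]
      length_le := fun c c' h => le_rfl
      symm := fun c c' h => by
        apply SimpleGraph.Walk.ext_support
        rw [SimpleGraph.Walk.support_reverse, hsupp, hsupp, hrev, hM]
        rfl
      nail_mem := fun c c' h w hw => by
        change Sum.inl w ∈ (P c c' h).support at hw
        rw [hsupp] at hw
        simpa using hw
      disjoint := fun c c' h d d' h' hne x hx hx' => by
        have key : ∀ c c' h x, x ∈ (P c c' h).support → x ∉ Set.range (Sum.inl : C → C ⊕ U) →
            ∃ u, x = .inr u ∧ s(c, c') = s(o u, o (M u)) := by
          intro c c' h x hx hn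
          rw [hsupp] at hx
          simp only [List.mem_cons, List.not_mem_nil, or_false] at hx
          rcases hx with rfl | rfl | rfl | rfl
          · exact absurd ⟨c, rfl⟩ hn
          · exact ⟨_, rfl, by rw [hmid1, hmid2]⟩
          · exact ⟨_, rfl, by rw [hM, hmid1, hmid2, Sym2.eq_swap]⟩
          · exact absurd ⟨c', rfl⟩ hn
        by_contra hn
        obtain ⟨u, rfl, h1⟩ := key c c' h x hx hn
        obtain ⟨u', h2, h3⟩ := key d d' h' _ hx' hn
        obtain rfl := Sum.inr_injective h2
        exact hne (h1.trans h3.symm) }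
  refine HasDenseHalfSTM.of_model model (le_of_eq ?_)
  have hdeg : ∀ c, H.degree c = D := fun c => by
    rw [← hD c, ← SimpleGraph.card_neighborSet_eq_degree, ← Nat.card_eq_fintype_card]
    refine (Nat.card_congr (Equiv.ofBijective
      (fun u => ⟨o (M u.1), u.1, u.2, rfl⟩ : {u // o u = c} → H.neighborSet c) ⟨?_, ?_⟩)).symm
    · rintro ⟨u, hu⟩ ⟨u', hu'⟩ h
      exact Subtype.ext (huniq u u' (hu.trans hu'.symm) (congrArg Subtype.val h))
    · rintro ⟨c', u, h1, h2⟩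
      exact ⟨⟨u, h1⟩, Subtype.ext h2⟩
  have hsum := H.sum_degrees_eq_twice_card_edges
  simp only [hdeg, Finset.sum_const, Finset.card_univ, smul_eq_mul] at hsum
  rw [Set.ncard_eq_toFinset_card', ← SimpleGraph.edgeFinset]
  have hpos : (0 : ℚ) < Fintype.card C := by exact_mod_cast Fintype.card_pos
  rw [div_eq_div_iff two_ne_zero hpos.ne']
  have : (Fintype.card C : ℚ) * D = 2 * (H.edgeFinset.card : ℚ) := by exact_mod_cast hsum
  linarith

/-- Paths of length at most three between core vertices run through two adjacent slots. -/
theorem slotGraph_path {a b : C ⊕ U} (p : (slotGraph o F).Walk a b) (hp : p.IsPath)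
    (hl : p.length ≤ 3) {c c' : C} (ha : a = .inl c) (hb : b = .inl c') (hn : a ≠ b) :
    ∃ u u', o u = c ∧ F.Adj u u' ∧ o u' = c' ∧ p.support = [.inl c, .inr u, .inr u', .inl c'] := by
  cases p with
  | nil => exact absurd rfl hn
  | @cons _ x _ h1 p =>
    subst ha
    rcases x with x | u
    · exact h1.elim
    cases p with
    | nil => simp at hb
    | @cons _ x _ h2 p =>
      rcases x with x | u'
      · have h3 : o u = c := h1
        have h4 : o u = x := h2
        have h5 : c = x := h3.symm.trans h4
        simp [SimpleGraph.Walk.cons_isPath_iff, h5] at hp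
      cases p with
      | nil => simp at hb
      | @cons _ x _ h3 p =>
        cases p with
        | nil =>
          subst hb
          exact ⟨u, u', h1, h2, h3, rfl⟩
        | @cons _ x _ h4 p =>
          simp only [SimpleGraph.Walk.length_cons] at hl
          omega

/-- If every core vertex has `D` slots and all slots have fewer than `D` neighbours, then all nails
of a minor of density `D / 2` are core vertices, their degrees in the minor are `D`, and each of
their slots is used by an edge of the minor. The set `N` consists of the nails, and `M` maps a slot
to the other slot on the same path. -/
theorem exists_matching_of_hasDenseHalfSTM [Fintype C] [Fintype U] {D : ℕ}
    (hD : ∀ c, Nat.card {u // o u = c} = D) (hF : ∀ u, (F.neighborSet u).ncard + 1 < D)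
    (h : HasDenseHalfSTM 2 (slotGraph o F) ((D : ℚ) / 2)) :
    ∃ N : Set C, N.Nonempty ∧ ∃ M : U → U, ∀ u, o u ∈ N → o (M u) ∈ N ∧ F.Adj u (M u) ∧
      M (M u) = u ∧ ∀ u', o u' = o u → o (M u') = o (M u) → u' = u := by
  classical
  obtain ⟨k, H, hk, ⟨m⟩, hd⟩ := h
  set G := slotGraph o F with hG
  -- The second vertices of the paths that start at a nail are distinct neighbours of the nail.
  have hnil : ∀ w v (h : H.Adj w v), ¬ (m.path w v h).Nil := fun w v h hn =>
    h.ne (m.nail.injective hn.eq)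
  have hinj : ∀ w v v' (h : H.Adj w v) (h' : H.Adj w v'),
      (m.path w v h).snd = (m.path w v' h').snd → v = v' := by
    intro w v v' h h' heq
    by_contra hvv
    have h1 : (m.path w v h).snd ∈ (m.path w v h).support :=
      SimpleGraph.Walk.getVert_mem_support _ _
    have h2 : (m.path w v h).snd ∈ (m.path w v' h').support := by
      rw [heq]; exact SimpleGraph.Walk.getVert_mem_support _ _
    obtain ⟨y, hy⟩ := m.disjoint w v h w v' h' (by simp [hvv, h'.ne]) _ h1 h2
    have h3 : y ≠ w := by
      rintro rfl
      exact ((m.path y v h).adj_snd (hnil _ _ _)).ne hy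
    rw [← hy] at h1 h2
    exact hvv (((m.nail_mem _ _ _ _ h1).resolve_left h3).symm.trans
      ((m.nail_mem _ _ _ _ h2).resolve_left h3))
  let fst : ∀ w, H.neighborSet w → G.neighborSet (m.nail w) := fun w v =>
    ⟨(m.path w v.1 v.2).snd, (m.path w v.1 v.2).adj_snd (hnil _ _ _)⟩
  have hfst : ∀ w, Function.Injective (fst w) := fun w v v' heq =>
    Subtype.ext (hinj w v.1 v'.1 v.2 v'.2 (congrArg Subtype.val heq))
  have hdeg : ∀ w, H.degree w ≤ (G.neighborSet (m.nail w)).ncard := fun w => by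
    rw [← SimpleGraph.card_neighborSet_eq_degree, ← Nat.card_eq_fintype_card]
    exact Nat.card_le_card_of_injective _ (hfst w)
  have hinl : ∀ c, (G.neighborSet (.inl c)).ncard = D := fun c => by
    have : G.neighborSet (.inl c) = Sum.inr '' {u | o u = c} := by
      ext x
      rcases x with x | x <;> simp [hG]
    rw [this, Set.ncard_image_of_injective _ Sum.inr_injective]
    exact hD c
  have hinr : ∀ u, (G.neighborSet (.inr u)).ncard < D := fun u => by
    have : G.neighborSet (.inr u) ⊆ insert (Sum.inl (o u)) (Sum.inr '' F.neighborSet u) := by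
      intro x hx
      rcases x with x | x
      · left; exact congrArg Sum.inl (show o u = x from hx).symm
      · right; exact ⟨x, hx, rfl⟩
    refine (Set.ncard_le_ncard this).trans_lt ((Set.ncard_insert_le _ _).trans_lt ?_)
    rw [Set.ncard_image_of_injective _ Sum.inr_injective]
    exact hF u
  have hle : ∀ w, H.degree w ≤ D := fun w => (hdeg w).trans (by
    rcases hw : m.nail w with c | u
    · exact (hinl c).le
    · exact (hinr u).le)
  have heq : ∀ w, H.degree w = D := by
    have hsum := H.sum_degrees_eq_twice_card_edges
    have h1 : (D : ℚ) * k ≤ 2 * (H.edgeFinset.card : ℚ) := by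
      rw [Set.ncard_eq_toFinset_card', ← SimpleGraph.edgeFinset] at hd
      have hk' : (0 : ℚ) < k := by exact_mod_cast hk
      rw [div_le_div_iff₀ two_pos hk'] at hd
      linarith
    have h2 : ∑ w : Fin k, D ≤ ∑ w, H.degree w := by
      rw [hsum, Finset.sum_const, Finset.card_univ, Fintype.card_fin, smul_eq_mul, mul_comm]
      exact_mod_cast h1
    have h3 := (Finset.sum_eq_sum_iff_of_le fun w _ => hle w).1
      (le_antisymm (Finset.sum_le_sum fun w _ => hle w) h2)
    exact fun w => h3 w (Finset.mem_univ w)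
  have hcore : ∀ w, ∃ c, m.nail w = .inl c := fun w => by
    rcases hw : m.nail w with c | u
    · exact ⟨c, rfl⟩
    · have h1 := hdeg w
      rw [heq, hw] at h1
      exact absurd h1 (hinr u).not_ge
  have hsurj : ∀ w, Function.Surjective (fst w) := fun w => by
    refine ((Nat.bijective_iff_injective_and_card _).2 ⟨hfst w, ?_⟩).2
    obtain ⟨c, hc⟩ := hcore w
    rw [Nat.card_eq_fintype_card, SimpleGraph.card_neighborSet_eq_degree, heq]
    have := hinl c
    rw [← hc] at this
    exact this.symm
  -- The slots that are matched by an edge of the minor.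
  let R : U → U → Prop := fun u u' => ∃ w v, ∃ h : H.Adj w v, m.nail w = .inl (o u) ∧
    m.nail v = .inl (o u') ∧ F.Adj u u' ∧
    (m.path w v h).support = [.inl (o u), .inr u, .inr u', .inl (o u')]
  have hsnd : ∀ {a b : C ⊕ U} (p : G.Walk a b) {x y : C ⊕ U} {l : List (C ⊕ U)},
      p.support = x :: y :: l → p.snd = y := by
    intro a b p x y l hp
    cases p with
    | nil => simp at hp
    | cons h p =>
      rw [SimpleGraph.Walk.snd_cons]
      rw [SimpleGraph.Walk.support_cons, ← SimpleGraph.Walk.cons_tail_support] at hp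
      simp only [List.cons.injEq] at hp
      exact hp.2.1
  have hex : ∀ u, o u ∈ {c | Sum.inl c ∈ Set.range m.nail} → ∃ u', R u u' := by
    rintro u ⟨w, hw⟩
    obtain ⟨⟨v, hv⟩, hvu⟩ := hsurj w ⟨.inr u, by rw [hw]; exact rfl⟩
    obtain ⟨c', hc'⟩ := hcore v
    obtain ⟨u₁, u₂, h1, h2, h3, h4⟩ := slotGraph_path (m.path w v hv) (m.isPath _ _ _)
      (m.length_le _ _ _) hw hc' fun h => hv.ne (m.nail.injective h)
    have h5 : (m.path w v hv).snd = .inr u := congrArg Subtype.val hvu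
    rw [hsnd _ h4] at h5
    obtain rfl := Sum.inr_injective h5
    exact ⟨u₂, w, v, hv, hw, by rw [hc', h3], h2, by rw [h4, h3]⟩
  have hsymm : ∀ u u', R u u' → R u' u := by
    rintro u u' ⟨w, v, h, h1, h2, h3, h4⟩
    refine ⟨v, w, h.symm, h2, h1, h3.symm, ?_⟩
    rw [m.symm w v h, SimpleGraph.Walk.support_reverse, h4]
    rfl
  have huniq : ∀ u u₁ u₂, R u u₁ → R u u₂ → u₁ = u₂ := by
    rintro u u₁ u₂ ⟨w, v, h, h1, h2, h3, h4⟩ ⟨w', v', h', h1', h2', h3', h4'⟩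
    obtain rfl : w = w' := m.nail.injective (h1.trans h1'.symm)
    obtain rfl : v = v' := hinj w v v' h h' (by rw [hsnd _ h4, hsnd _ h4'])
    rw [h4] at h4'
    simpa using (List.cons.inj (List.cons.inj (List.cons.inj h4').2).2).1
  choose! M hM using hex
  refine ⟨{c | Sum.inl c ∈ Set.range m.nail}, ?_, M, fun u hu => ?_⟩
  · obtain ⟨c, hc⟩ := hcore ⟨0, hk⟩
    exact ⟨c, ⟨0, hk⟩, hc⟩
  · have hR := hM u hu
    obtain ⟨w, v, h, h1, h2, h3, h4⟩ := hR
    have hact : o (M u) ∈ {c | Sum.inl c ∈ Set.range m.nail} := ⟨v, h2⟩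
    refine ⟨hact, h3, huniq _ _ _ (hM _ hact) (hsymm _ _ (hM u hu)), fun u' e1 e2 => ?_⟩
    obtain ⟨w', v', h', h1', h2', h3', h4'⟩ := hM u' (by rw [e1]; exact hu)
    obtain rfl : w' = w := m.nail.injective (by rw [h1', h1, e1])
    obtain rfl : v' = v := m.nail.injective (by rw [h2', h2, e2])
    rw [h4] at h4'
    simpa using (List.cons.inj (List.cons.inj h4').2).1.symm

end SlotGraph
/-! ### The layered slot graph -/

/-- The four groups of slots of a core vertex. -/
inductive Role : Type
  | a | b | c | d
  deriving DecidableEq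

instance : Fintype Role :=
  ⟨{.a, .b, .c, .d}, fun r => by cases r <;> decide⟩

section Layered

variable {L : ℕ} {I : Type}

/-- The slots of the layered graph: layer and index of the core vertex, role, and index. The index
`none` belongs to the hub of a layer, and to the slots outside of the cycles. -/
abbrev Slot (L : ℕ) (I : Type) : Type := ZMod L × Option I × Role × Option I

/-- The core vertex of a slot. -/
def owner (u : Slot L I) : ZMod L × Option I := (u.1, u.2.1)

/-- The directed edges between slots. The first four kinds form, for every layer `m` and every
pair `(i, j)`, a cycle of length four with owners `(m, i)`, `(m + 1, j)`, `(m + 2, i)` and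
`(m + 5, j)`. The slots `(m, i, a)`, `(m + 2, i, b)` and `(m + 5, i, c)` with last index `none` are
the literal slots of layer `m`, and `Lit m p q v` says that the clause of the layer contains the
literal with sign `v` of the variable `(p, q)`. -/
inductive Arc (z : I) (Lit : ZMod L → I → I → Bool → Prop) : Slot L I → Slot L I → Prop
  | cycle_ab {m m' i j} : m' = m + 1 → Arc z Lit (m, some i, .a, some j) (m', some j, .b, some i)
  | cycle_bc {m m' i j} : m' = m + 1 → Arc z Lit (m, some i, .b, some j) (m', some j, .c, some i)
  | cycle_cd {m m' i j} : m' = m + 3 → Arc z Lit (m, some i, .c, some j) (m', some j, .d, some i)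
  | cycle_ad {m m' i j} : m' = m + 5 → Arc z Lit (m, some i, .a, some j) (m', some j, .d, some i)
  | pos_self {m i} : i ≠ z → Arc z Lit (m, none, .a, some i) (m, some i, .a, none)
  | pos_zero {m i i'} : i ≠ z → i' = z → Arc z Lit (m, none, .a, some i) (m, some i', .a, none)
  | neg_self {m m' i} : m' = m + 2 → Arc z Lit (m, none, .b, some i) (m', some i, .b, none)
  | neg_zero {m i i'} : i' = z → Arc z Lit (m, none, .b, some i) (m, some i', .a, none)
  | end_self {m m' i} : m' = m + 5 → i ≠ z →
      Arc z Lit (m, none, .c, some i) (m', some i, .c, none)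
  | end_zero {m m' i i'} : m' = m + 5 → i ≠ z → i' = z →
      Arc z Lit (m, none, .c, some i) (m', some i', .c, none)
  | hub {m m' i} : m' = m + 1 → Arc z Lit (m, none, .d, some i) (m', some i, .d, none)
  | hub_three {m m' i i'} : m' = m + 3 → i = z → i' = z →
      Arc z Lit (m, none, .a, some i) (m', none, .c, some i')
  | hub_one {m m'} : m' = m + 1 → Arc z Lit (m, none, .a, none) (m', none, .b, none)
  | hub_two {m m'} : m' = m + 2 → Arc z Lit (m, none, .c, none) (m', none, .d, none)
  | pos {m m' p q} : m' = m + 5 → Lit m p q true →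
      Arc z Lit (m, some p, .a, none) (m', some q, .c, none)
  | neg {m m' p q} : m' = m + 3 → Lit (m - 2) p q false →
      Arc z Lit (m, some p, .b, none) (m', some q, .c, none)

variable {z : I} {Lit : ZMod L → I → I → Bool → Prop}

theorem Arc.ne {u v : Slot L I} (h : Arc z Lit u v) : u ≠ v := by
  cases h <;> simp

/-- The graph on the slots. -/
def slotEdges (z : I) (Lit : ZMod L → I → I → Bool → Prop) : SimpleGraph (Slot L I) where
  Adj u v := Arc z Lit u v ∨ Arc z Lit v u
  symm := ⟨fun _ _ h => h.symm⟩
  loopless := ⟨fun _ h => h.elim (fun h => h.ne rfl) fun h => h.ne rfl⟩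

theorem card_slots [Fintype I] (c : ZMod L × Option I) :
    Nat.card {u : Slot L I // owner u = c} = 4 * Fintype.card I + 4 := by
  have e : {u : Slot L I // owner u = c} ≃ Role × Option I :=
    { toFun := fun u => u.1.2.2
      invFun := fun x => ⟨(c.1, c.2, x), rfl⟩
      left_inv := by rintro ⟨⟨m, i, x⟩, rfl⟩; rfl
      right_inv := fun x => rfl }
  rw [Nat.card_congr e, Nat.card_eq_fintype_card, Fintype.card_prod, Fintype.card_option]
  have : Fintype.card Role = 4 := rfl
  rw [this]
  ring

/-- The neighbours of a slot lie in at most three families indexed by `Option I`. -/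
theorem slotEdges_neighborSet (u : Slot L I) : ∃ f₀ f₁ f₂ : Option I → Slot L I,
    ∀ v, (slotEdges z Lit).Adj u v → (∃ x, v = f₀ x) ∨ (∃ x, v = f₁ x) ∨ ∃ x, v = f₂ x := by
  rcases u with ⟨m, i | i, r, j | j⟩ <;> cases r
  · exact ⟨fun _ => (m + 1, none, .b, none), fun _ => (m, none, .a, none),
      fun _ => (m, none, .a, none),
      by rintro v (h | h) <;> cases h <;> simp_all⟩
  · exact ⟨fun _ => (m - 1, none, .a, none), fun _ => (m, none, .a, none),
      fun _ => (m, none, .a, none),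
      by rintro v (h | h) <;> cases h <;> simp_all⟩
  · exact ⟨fun _ => (m + 2, none, .d, none), fun _ => (m, none, .a, none),
      fun _ => (m, none, .a, none),
      by rintro v (h | h) <;> cases h <;> simp_all⟩
  · exact ⟨fun _ => (m - 2, none, .c, none), fun _ => (m, none, .a, none),
      fun _ => (m, none, .a, none),
      by rintro v (h | h) <;> cases h <;> simp_all⟩
  · exact ⟨fun x => (m, x, .a, none), fun x => (m + 3, none, .c, x),
      fun _ => (m, none, .a, none),
      by rintro v (h | h) <;> cases h <;> simp_all⟩
  · exact ⟨fun x => (m, x, .a, none), fun x => (m + 2, x, .b, none),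
      fun _ => (m, none, .a, none),
      by rintro v (h | h) <;> cases h <;> simp_all⟩
  · exact ⟨fun x => (m - 3, none, .a, x), fun x => (m + 5, x, .c, none),
      fun _ => (m, none, .a, none),
      by rintro v (h | h) <;> cases h <;> simp_all⟩
  · exact ⟨fun x => (m + 1, x, .d, none), fun _ => (m, none, .a, none),
      fun _ => (m, none, .a, none),
      by rintro v (h | h) <;> cases h <;> simp_all⟩
  · exact ⟨fun x => (m, none, .a, x), fun x => (m, none, .b, x),
      fun x => (m + 5, x, .c, none),
      by rintro v (h | h) <;> cases h <;> simp_all⟩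
  · exact ⟨fun x => (m - 2, none, .b, x), fun x => (m + 3, x, .c, none),
      fun _ => (m, none, .a, none),
      by rintro v (h | h) <;> cases h <;> simp_all⟩
  · exact ⟨fun x => (m - 5, none, .c, x), fun x => (m - 5, x, .a, none),
      fun x => (m - 3, x, .b, none),
      by rintro v (h | h) <;> cases h <;> simp_all⟩
  · exact ⟨fun x => (m - 1, none, .d, x), fun _ => (m, none, .a, none),
      fun _ => (m, none, .a, none),
      by rintro v (h | h) <;> cases h <;> simp_all⟩
  · exact ⟨fun _ => (m + 1, some j, .b, some i), fun _ => (m + 5, some j, .d, some i),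
      fun _ => (m, none, .a, none),
      by rintro v (h | h) <;> cases h <;> simp_all⟩
  · exact ⟨fun _ => (m + 1, some j, .c, some i), fun _ => (m - 1, some j, .a, some i),
      fun _ => (m, none, .a, none),
      by rintro v (h | h) <;> cases h <;> simp_all⟩
  · exact ⟨fun _ => (m + 3, some j, .d, some i), fun _ => (m - 1, some j, .b, some i),
      fun _ => (m, none, .a, none),
      by rintro v (h | h) <;> cases h <;> simp_all⟩
  · exact ⟨fun _ => (m - 5, some j, .a, some i), fun _ => (m - 3, some j, .c, some i),
      fun _ => (m, none, .a, none),
      by rintro v (h | h) <;> cases h <;> simp_all⟩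

theorem slotEdges_degree [Fintype I] (hI : 0 < Fintype.card I) (u : Slot L I) :
    ((slotEdges z Lit).neighborSet u).ncard + 1 < 4 * Fintype.card I + 4 := by
  obtain ⟨f₀, f₁, f₂, h⟩ := slotEdges_neighborSet (z := z) (Lit := Lit) u
  have hsub : (slotEdges z Lit).neighborSet u ⊆ (Set.range f₀ ∪ Set.range f₁) ∪ Set.range f₂ := by
    intro v hv
    rcases h v hv with ⟨x, rfl⟩ | ⟨x, rfl⟩ | ⟨x, rfl⟩ <;> simp
  have hr : ∀ f : Option I → Slot L I, (Set.range f).ncard ≤ Fintype.card I + 1 := fun f => by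
    rw [← Set.image_univ]
    refine (Set.ncard_image_le Set.finite_univ).trans ?_
    rw [Set.ncard_univ, Nat.card_eq_fintype_card, Fintype.card_option]
  have h1 := Set.ncard_le_ncard hsub (Set.toFinite _)
  have h2 := Set.ncard_union_le (Set.range f₀ ∪ Set.range f₁) (Set.range f₂)
  have h3 := Set.ncard_union_le (Set.range f₀) (Set.range f₁)
  have := hr f₀
  have := hr f₁
  have := hr f₂
  omega

end Layered
/-! ### From a dense minor to a satisfying assignment -/

section Soundness

variable {L : ℕ} {I : Type} {z : I} {Lit : ZMod L → I → I → Bool → Prop}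

theorem slotEdges_adj_cycle_a {m : ZMod L} {i j : I} {v : Slot L I}
    (h : (slotEdges z Lit).Adj (m, some i, .a, some j) v) :
    v = (m + 1, some j, .b, some i) ∨ v = (m + 5, some j, .d, some i) := by
  rcases h with h | h <;> cases h <;> simp_all

theorem slotEdges_adj_cycle_b {m : ZMod L} {i j : I} {v : Slot L I}
    (h : (slotEdges z Lit).Adj (m, some i, .b, some j) v) :
    v = (m + 1, some j, .c, some i) ∨ v = (m - 1, some j, .a, some i) := by
  rcases h with h | h <;> cases h <;> simp_all

theorem slotEdges_adj_cycle_c {m : ZMod L} {i j : I} {v : Slot L I}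
    (h : (slotEdges z Lit).Adj (m, some i, .c, some j) v) :
    v = (m + 3, some j, .d, some i) ∨ v = (m - 1, some j, .b, some i) := by
  rcases h with h | h <;> cases h <;> simp_all

theorem slotEdges_adj_hub_one {m : ZMod L} {v : Slot L I}
    (h : (slotEdges z Lit).Adj (m, none, .a, none) v) : v = (m + 1, none, .b, none) := by
  rcases h with h | h <;> cases h <;> simp_all

theorem slotEdges_adj_hub {m : ZMod L} {i : I} {v : Slot L I}
    (h : (slotEdges z Lit).Adj (m, none, .d, some i) v) : v = (m + 1, some i, .d, none) := by
  rcases h with h | h <;> cases h <;> simp_all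

theorem slotEdges_adj_hub' {m : ZMod L} {i : I} {v : Slot L I}
    (h : (slotEdges z Lit).Adj (m, some i, .d, none) v) : v = (m - 1, none, .d, some i) := by
  rcases h with h | h <;> cases h
  simp_all

theorem slotEdges_adj_pos {m : ZMod L} {i : I} {v : Slot L I}
    (h : (slotEdges z Lit).Adj (m, some i, .a, none) v) :
    (∃ q, Lit m i q true ∧ v = (m + 5, some q, .c, none)) ∨
      (i ≠ z ∧ v = (m, none, .a, some i)) ∨
      (i = z ∧ ∃ j, v = (m, none, .b, some j) ∨ (j ≠ z ∧ v = (m, none, .a, some j))) := by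
  rcases h with h | h <;> cases h <;> simp_all

theorem slotEdges_adj_neg {m : ZMod L} {i : I} {v : Slot L I}
    (h : (slotEdges z Lit).Adj (m, some i, .b, none) v) :
    (∃ q, Lit (m - 2) i q false ∧ v = (m + 3, some q, .c, none)) ∨
      v = (m - 2, none, .b, some i) := by
  rcases h with h | h <;> cases h <;> simp_all

variable [Fintype I] [NeZero L]

/-- In a dense minor every cycle is matched in one of two ways. The way `y m i j` found on the
cycle of `(i, j)` in layer `m` is passed on to the cycle of `(j, i)` in layer `m + 1`, as the
edge of the minor between `(m + 1, j)` and `(m + 2, i)` cannot be used twice. As the `2 |I|`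
literal slots of a layer with the last index `none` and role `a` or `b` have only `2 |I| - 1`
partners among the slots of the hub, one of them is matched along a literal of the clause, which
uses an edge of the minor that is available only when the literal is true. -/
theorem exists_consistent_of_hasDenseHalfSTM
    (h : HasDenseHalfSTM 2 (slotGraph owner (slotEdges z Lit))
      (((4 * Fintype.card I + 4 : ℕ) : ℚ) / 2)) :
    ∃ y : ZMod L → I → I → Prop, (∀ m p q, y m p q → y (m + 1) q p) ∧
      ∀ m, ∃ p q, (Lit m p q true ∧ ¬ y m p q) ∨ (Lit m p q false ∧ y m p q) := by
  have hI : 0 < Fintype.card I := Fintype.card_pos_iff.2 ⟨z⟩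
  obtain ⟨N, ⟨c₀, hc₀⟩, M, hM⟩ :=
    exists_matching_of_hasDenseHalfSTM card_slots (slotEdges_degree hI) h
  -- The edges that every matching uses make all core vertices nails.
  have h1 : ∀ m, (m, none) ∈ N → (m + 1, none) ∈ N := fun m hm => by
    obtain ⟨h1, h2, -⟩ := hM (m, none, .a, none) hm
    rwa [slotEdges_adj_hub_one h2] at h1
  have h2 : ∀ m, (m, none) ∈ N → ∀ i, (m + 1, some i) ∈ N := fun m hm i => by
    obtain ⟨h1, h2, -⟩ := hM (m, none, .d, some i) hm
    rwa [slotEdges_adj_hub h2] at h1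
  have h3 : ∃ m, (m, none) ∈ N := by
    obtain ⟨m, i | i⟩ := c₀
    · exact ⟨m, hc₀⟩
    · obtain ⟨h1, h2, -⟩ := hM (m, some i, .d, none) hc₀
      rw [slotEdges_adj_hub' h2] at h1
      exact ⟨m - 1, h1⟩
  have h4 : ∀ m, (m, none) ∈ N := by
    obtain ⟨m₀, hm₀⟩ := h3
    have : ∀ k : ℕ, (m₀ + k, none) ∈ N := fun k => by
      induction k with
      | zero => simpa using hm₀
      | succ k ih =>
        have := h1 _ ih
        rwa [add_assoc, ← Nat.cast_add_one] at this
    intro m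
    have := this (m - m₀).val
    rwa [ZMod.natCast_zmod_val, add_sub_cancel] at this
  have hall : ∀ c, c ∈ N := by
    rintro ⟨m, i | i⟩
    · exact h4 m
    · have := h2 (m - 1) (h4 _) i
      rwa [sub_add_cancel] at this
  have hA : ∀ u, (slotEdges z Lit).Adj u (M u) := fun u => (hM u (hall _)).2.1
  have hinv : ∀ u, M (M u) = u := fun u => (hM u (hall _)).2.2.1
  have huniq : ∀ u u', owner u' = owner u → owner (M u') = owner (M u) → u' = u :=
    fun u => (hM u (hall _)).2.2.2
  -- The two ways in which a cycle is matched.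
  have hy : ∀ m i j, M (m, some i, .a, some j) = (m + 5, some j, .d, some i) →
      M (m + 1, some j, .b, some i) = (m + 2, some i, .c, some j) := by
    intro m i j h
    rcases slotEdges_adj_cycle_b (hA (m + 1, some j, .b, some i)) with h' | h'
    · rw [h']; congr 1; ring
    · have := hinv (m + 1, some j, .b, some i)
      rw [h', add_sub_cancel_right, h] at this
      simp at this
  have hn : ∀ m i j, M (m, some i, .a, some j) ≠ (m + 5, some j, .d, some i) →
      M (m, some i, .a, some j) = (m + 1, some j, .b, some i) ∧
      M (m + 2, some i, .c, some j) = (m + 5, some j, .d, some i) := by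
    intro m i j h
    have h1 := (slotEdges_adj_cycle_a (hA (m, some i, .a, some j))).resolve_right h
    refine ⟨h1, ?_⟩
    rcases slotEdges_adj_cycle_c (hA (m + 2, some i, .c, some j)) with h' | h'
    · rw [h']; congr 1; ring
    · have h2 := hinv (m + 2, some i, .c, some j)
      have h3 : m + 2 - 1 = m + 1 := by ring
      rw [h', h3, ← h1, hinv] at h2
      simp at h2
  refine ⟨fun m p q => M (m, some p, .a, some q) = (m + 5, some q, .d, some p), ?_, fun m => ?_⟩
  · intro m p q h
    by_contra hcon
    have e1 := hy m p q h
    have e2 := (hn (m + 1) q p hcon).1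
    have e3 := huniq (m + 1, some q, .a, some p) (m + 1, some q, .b, some p) rfl (by
      rw [e1, e2]
      simp only [owner, Prod.mk.injEq, and_true]
      ring)
    simp at e3
  · have hpos : ∀ i q, Lit m i q true → M (m, some i, .a, none) = (m + 5, some q, .c, none) →
        Lit m i q true ∧ ¬ M (m, some i, .a, some q) = (m + 5, some q, .d, some i) := by
      refine fun i q hl h => ⟨hl, fun h' => ?_⟩
      have := huniq (m, some i, .a, none) (m, some i, .a, some q) rfl (by rw [h, h']; rfl)
      simp at this
    have hneg : ∀ i q, Lit m i q false → M (m + 2, some i, .b, none) = (m + 5, some q, .c, none) →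
        Lit m i q false ∧ M (m, some i, .a, some q) = (m + 5, some q, .d, some i) := by
      refine fun i q hl h => ⟨hl, by_contra fun h' => ?_⟩
      have := huniq (m + 2, some i, .b, none) (m + 2, some i, .c, some q) rfl (by
        rw [h, (hn m i q h').2]; rfl)
      simp at this
    have hneg' : ∀ i, M (m + 2, some i, .b, none) ≠ (m, none, .b, some i) → ∃ q,
        Lit m i q false ∧ M (m + 2, some i, .b, none) = (m + 5, some q, .c, none) := by
      intro i h
      have e1 : m + 2 - 2 = m := by ring
      have e2 : m + 2 + 3 = m + 5 := by ring
      rcases slotEdges_adj_neg (hA (m + 2, some i, .b, none)) with ⟨q, h1, h2⟩ | h'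
      · rw [e1] at h1
        rw [e2] at h2
        exact ⟨q, h1, h2⟩
      · rw [e1] at h'
        exact absurd h' h
    rcases slotEdges_adj_pos (hA (m, some z, .a, none)) with ⟨q, h1, h2⟩ | ⟨h1, -⟩ | ⟨-, j, h1 | h1⟩
    · exact ⟨z, q, Or.inl (hpos z q h1 h2)⟩
    · exact absurd rfl h1
    · obtain ⟨q, h2, h3⟩ := hneg' j fun h => by
        have h2 := hinv (m + 2, some j, .b, none)
        rw [h, ← h1, hinv] at h2
        simp at h2
      exact ⟨j, q, Or.inr (hneg j q h2 h3)⟩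
    · obtain ⟨h0, h1⟩ := h1
      rcases slotEdges_adj_pos (hA (m, some j, .a, none)) with ⟨q, h2, h3⟩ | ⟨-, h2⟩ | ⟨h2, -⟩
      · exact ⟨j, q, Or.inl (hpos j q h2 h3)⟩
      · have h3 := hinv (m, some j, .a, none)
        rw [h2, ← h1, hinv] at h3
        simp at h3
        exact absurd h3.symm h0
      · exact absurd h2 h0

end Soundness
/-! ### From a satisfying assignment to a dense minor -/

section Completeness

variable {L : ℕ} {I : Type} [DecidableEq I]

/-- The perfect matching of the slots. `y m i j` says how the cycle of `(i, j)` in layer `m` is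
matched, and `(p m, q m)` is the variable of a true literal in the clause of layer `m`, with the
sign `v m`. The two slots of this literal are matched with each other. The slot `(m, z, a)`, which
is adjacent to all slots of the hub that belong to literals, takes over the partner of the first
one, unless it is the first one itself, and `(m + 5, z, c)` likewise for the second one. -/
def matching (z : I) (y : ZMod L → I → I → Bool) (p q : ZMod L → I) (v : ZMod L → Bool) :
    Slot L I → Slot L I
  | (m, some i, .a, some j) =>
      if y m i j then (m + 5, some j, .d, some i) else (m + 1, some j, .b, some i)
  | (m, some i, .b, some j) =>
      if y (m - 1) j i then (m + 1, some j, .c, some i) else (m - 1, some j, .a, some i)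
  | (m, some i, .c, some j) =>
      if y (m - 2) i j then (m - 1, some j, .b, some i) else (m + 3, some j, .d, some i)
  | (m, some i, .d, some j) =>
      if y (m - 5) j i then (m - 5, some j, .a, some i) else (m - 3, some j, .c, some i)
  | (m, some i, .a, none) =>
      if v m = true ∧ p m = i then (m + 5, some (q m), .c, none) else
      if i = z then (if v m = true then (m, none, .a, some (p m)) else (m, none, .b, some (p m)))
      else (m, none, .a, some i)
  | (m, some i, .b, none) =>
      if v (m - 2) = false ∧ p (m - 2) = i then (m + 3, some (q (m - 2)), .c, none) else
      (m - 2, none, .b, some i)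
  | (m, some i, .c, none) =>
      if q (m - 5) = i then (if v (m - 5) = true then (m - 5, some (p (m - 5)), .a, none) else
        (m - 3, some (p (m - 5)), .b, none)) else
      if i = z then (m - 5, none, .c, some (q (m - 5))) else (m - 5, none, .c, some i)
  | (m, some i, .d, none) => (m - 1, none, .d, some i)
  | (m, none, .a, some j) =>
      if j = z then (m + 3, none, .c, some z) else
      if v m = true ∧ p m = j then (m, some z, .a, none) else (m, some j, .a, none)
  | (m, none, .b, some j) =>
      if v m = false ∧ p m = j then (m, some z, .a, none) else (m + 2, some j, .b, none)
  | (m, none, .c, some j) =>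
      if j = z then (m - 3, none, .a, some z) else
      if q m = j then (m + 5, some z, .c, none) else (m + 5, some j, .c, none)
  | (m, none, .d, some j) => (m + 1, some j, .d, none)
  | (m, none, .a, none) => (m + 1, none, .b, none)
  | (m, none, .b, none) => (m - 1, none, .a, none)
  | (m, none, .c, none) => (m + 2, none, .d, none)
  | (m, none, .d, none) => (m - 2, none, .c, none)

variable {z : I} {y : ZMod L → I → I → Bool} {p q : ZMod L → I} {v : ZMod L → Bool}

theorem matching_matching (u : Slot L I) :
    matching z y p q v (matching z y p q v u) = u := by
  have e1 : ∀ m : ZMod L, m + 3 - 5 = m - 2 := fun m => by ring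
  have e2 : ∀ m : ZMod L, m - 1 - 1 = m - 2 := fun m => by ring
  have e3 : ∀ m : ZMod L, m - 3 - 2 = m - 5 := fun m => by ring
  have e4 : ∀ m : ZMod L, m + 1 - 2 = m - 1 := fun m => by ring
  have e5 : ∀ m : ZMod L, m - 2 + 5 = m + 3 := fun m => by ring
  have e6 : ∀ m : ZMod L, m + 2 - 1 = m + 1 := fun m => by ring
  have e7 : ∀ m : ZMod L, m + 5 - 3 = m + 2 := fun m => by ring
  have e8 : ∀ m : ZMod L, m - 2 + 1 = m - 1 := fun m => by ring
  have e9 : ∀ m : ZMod L, m - 5 + 2 = m - 3 := fun m => by ring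
  have e10 : ∀ m : ZMod L, m - 3 + 3 = m := fun m => by ring
  have e11 : ∀ m : ZMod L, m - 1 + 1 = m := fun m => by ring
  rcases u with ⟨m, i | i, r, j | j⟩ <;> cases r <;> simp only [matching] <;>
    (try split_ifs) <;> simp_all

theorem slotEdges_adj_matching {Lit : ZMod L → I → I → Bool → Prop}
    (hlit : ∀ m, Lit m (p m) (q m) (v m)) (u : Slot L I) :
    (slotEdges z Lit).Adj u (matching z y p q v u) := by
  have e₁ : ∀ m : ZMod L, m - 1 + 1 = m := fun m => by ring
  have e₂ : ∀ m : ZMod L, m - 2 + 2 = m := fun m => by ring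
  have e₃ : ∀ m : ZMod L, m - 3 + 3 = m := fun m => by ring
  have e₅ : ∀ m : ZMod L, m - 5 + 5 = m := fun m => by ring
  have e₆ : ∀ m : ZMod L, m - 3 - 2 = m - 5 := fun m => by ring
  have hl : ∀ {m i b}, v m = b → p m = i → Lit m i (q m) b := fun h h' => h ▸ h' ▸ hlit _
  rcases u with ⟨m, i | i, r, j | j⟩ <;> cases r <;> simp only [matching] <;>
    (try split_ifs) <;> try subst_vars
  all_goals first
    | (left; constructor <;> first
        | rfl | assumption | exact hl (by simp_all) (by simp_all))
    | (right; constructor <;> first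
        | rfl | assumption | exact (e₁ _).symm | exact (e₂ _).symm | exact (e₃ _).symm
        | exact (e₅ _).symm | (intro h; simp_all)
        | (try rw [e₆]
           exact hl (by simp_all) (by simp_all)))

/-- The differences of layers that occur in the graph are distinct modulo `L ≥ 12`. -/
theorem layer_differences_ne (hL : 12 ≤ L) :
    (-1 : ZMod L) ≠ 1 ∧ (5 : ZMod L) ≠ 1 ∧ (5 : ZMod L) ≠ -1 ∧ (3 : ZMod L) ≠ 1 ∧
    (3 : ZMod L) ≠ -1 ∧ (3 : ZMod L) ≠ 5 ∧ (-5 : ZMod L) ≠ 1 ∧ (-5 : ZMod L) ≠ -1 ∧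
    (-5 : ZMod L) ≠ 5 ∧ (-5 : ZMod L) ≠ 3 ∧ (-3 : ZMod L) ≠ 1 ∧ (-3 : ZMod L) ≠ -1 ∧
    (-3 : ZMod L) ≠ 5 ∧ (-3 : ZMod L) ≠ 3 ∧ (-3 : ZMod L) ≠ -5 ∧ (-2 : ZMod L) ≠ 0 ∧
    (-5 : ZMod L) ≠ 0 ∧ (-5 : ZMod L) ≠ -2 ∧ (-1 : ZMod L) ≠ 0 ∧ (-1 : ZMod L) ≠ -2 ∧
    (-1 : ZMod L) ≠ -5 ∧ (2 : ZMod L) ≠ 0 ∧ (5 : ZMod L) ≠ 0 ∧ (5 : ZMod L) ≠ 2 ∧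
    (1 : ZMod L) ≠ 0 ∧ (1 : ZMod L) ≠ 2 ∧ (1 : ZMod L) ≠ 5 ∧ (1 : ZMod L) ≠ 3 ∧
    (1 : ZMod L) ≠ -3 ∧ (-1 : ZMod L) ≠ 3 ∧ (-1 : ZMod L) ≠ -3 ∧ (2 : ZMod L) ≠ 3 ∧
    (2 : ZMod L) ≠ -3 ∧ (2 : ZMod L) ≠ 1 ∧ (2 : ZMod L) ≠ -1 ∧ (-2 : ZMod L) ≠ 3 ∧
    (-2 : ZMod L) ≠ -3 ∧ (-2 : ZMod L) ≠ 1 ∧ (-2 : ZMod L) ≠ -1 ∧ (-2 : ZMod L) ≠ 2 ∧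
    (3 : ZMod L) ≠ 0 := by
  have K : ∀ k : ℕ, 0 < k → k < 12 → (k : ZMod L) ≠ 0 := fun k h0 h => by
    rw [Ne, ZMod.natCast_eq_zero_iff]
    exact fun h' => absurd (Nat.le_of_dvd h0 h') (by omega)
  have K1 := K 1 (by norm_num) (by norm_num)
  have K2 := K 2 (by norm_num) (by norm_num)
  have K3 := K 3 (by norm_num) (by norm_num)
  have K4 := K 4 (by norm_num) (by norm_num)
  have K5 := K 5 (by norm_num) (by norm_num)
  have K6 := K 6 (by norm_num) (by norm_num)
  have K7 := K 7 (by norm_num) (by norm_num)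
  have K8 := K 8 (by norm_num) (by norm_num)
  have K10 := K 10 (by norm_num) (by norm_num)
  push_cast at K1 K2 K3 K4 K5 K6 K7 K8 K10
  constructorm* _ ∧ _ <;> rw [← sub_ne_zero] <;> norm_num <;> assumption

/-- The slot with a given owner and a given owner of its partner in the matching. It is found from
the difference of the layers. -/
def slotTo (z : I) (y : ZMod L → I → I → Bool) (p q : ZMod L → I) (v : ZMod L → Bool) :
    ZMod L × Option I → ZMod L × Option I → Slot L I
  | (m, some i), (m', some j) =>
      (m, some i,
        if m' - m = 1 then (if y (m - 1) j i then (.b, some j) else (.a, some j)) else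
        if m' - m = -1 then (if y (m - 2) i j then (.c, some j) else (.b, some j)) else
        if m' - m = 5 then (if y m i j then (.a, some j) else (.a, none)) else
        if m' - m = 3 then (if y (m - 2) i j then (.b, none) else (.c, some j)) else
        if m' - m = -5 then (if y (m - 5) j i then (.d, some j) else (.c, none)) else
        (if y (m - 5) j i then (.c, none) else (.d, some j)))
  | (m, some i), (m', none) =>
      (m, some i,
        if m' - m = 0 then (.a, none) else if m' - m = -2 then (.b, none) else
        if m' - m = -5 then (.c, none) else (.d, none))
  | (m, none), (m', some j) =>
      (m, none,
        if m' - m = 0 then (if j = z then (if v m then (.a, some (p m)) else (.b, some (p m)))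
          else (.a, some j)) else
        if m' - m = 2 then (.b, some j) else
        if m' - m = 5 then (if j = z then (.c, some (q m)) else (.c, some j)) else (.d, some j))
  | (m, none), (m', none) =>
      (m, none,
        if m' - m = 3 then (.a, some z) else if m' - m = -3 then (.c, some z) else
        if m' - m = 1 then (.a, none) else if m' - m = -1 then (.b, none) else
        if m' - m = 2 then (.c, none) else (.d, none))

theorem slotTo_owner (hL : 12 ≤ L) (hy : ∀ m i j, y m i j = true → y (m + 1) j i = true)
    (hyv : ∀ m, y m (p m) (q m) = !v m) (u : Slot L I) :
    slotTo z y p q v (owner u) (owner (matching z y p q v u)) = u := by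
  have hy1 : ∀ m i j, y m j i = false → y (m - 1) i j = false := fun m i j h => by
    by_contra h'
    have := hy _ _ _ (Bool.not_eq_false _ ▸ h')
    rw [sub_add_cancel, h] at this
    simp at this
  have hy2 : ∀ m i j, y (m - 1) j i = false → y (m - 2) i j = false := fun m i j h => by
    have := hy1 (m - 1) i j h
    rwa [show m - 1 - 1 = m - 2 by ring] at this
  have hδ := layer_differences_ne hL
  rcases u with ⟨m, i | i, r, j | j⟩ <;> cases r <;> simp only [matching] <;> (try split_ifs) <;>
    simp only [owner, slotTo, add_sub_cancel_left, sub_sub_cancel_left, sub_self, if_true, if_false,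
      hδ] <;> simp_all
  · rename_i h
    rw [← h.2, hyv, h.1]; rfl
  · rename_i h
    rw [← h.2, hyv, h.1]; rfl
  · rename_i h h'
    rw [← h, hyv, h']; rfl
  · rename_i h h'
    rw [← h, hyv, h']; rfl

theorem owner_ne_owner_matching (hL : 12 ≤ L) (u : Slot L I) :
    owner u ≠ owner (matching z y p q v u) := by
  have hδ := layer_differences_ne hL
  rcases u with ⟨m, i | i, r, j | j⟩ <;> cases r <;> simp only [matching] <;> (try split_ifs) <;>
    simp [owner, hδ, sub_eq_add_neg]

/-- Values of the cycles that are passed on along the layers, and a true literal for every layer,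
yield a dense minor. -/
theorem hasDenseHalfSTM_of_consistent [Fintype I] [NeZero L] {Lit : ZMod L → I → I → Bool → Prop}
    (hL : 12 ≤ L) (hy : ∀ m i j, y m i j = true → y (m + 1) j i = true)
    (hlit : ∀ m, ∃ p q b, Lit m p q b ∧ y m p q = !b) :
    HasDenseHalfSTM 2 (slotGraph owner (slotEdges z Lit))
      (((4 * Fintype.card I + 4 : ℕ) : ℚ) / 2) := by
  choose p q v hlit hyv using hlit
  have : Fintype (ZMod L) := ZMod.fintype L
  refine hasDenseHalfSTM_of_matching card_slots (matching z y p q v)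
    (slotEdges_adj_matching hlit) matching_matching (owner_ne_owner_matching hL) ?_
  intro u u' h h'
  rw [← slotTo_owner (z := z) hL hy hyv u, h, h', slotTo_owner hL hy hyv u']

end Completeness
/-! ### The constructed matrix is the adjacency matrix of the layered graph -/

section Bridge

variable {s L : ℕ}

/-- The number of a role. -/
def Role.toNat : Role → ℕ
  | .a => 0
  | .b => 1
  | .c => 2
  | .d => 3

/-- The number of an index; `none` has the number `s`. -/
def indexNat : Option (Fin s) → ℕ
  | some i => i
  | none => s

@[simp] theorem indexNat_some (i : Fin s) : indexNat (some i) = i := rfl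
@[simp] theorem indexNat_none : indexNat (none : Option (Fin s)) = s := rfl

theorem indexNat_le (i : Option (Fin s)) : indexNat i ≤ s := by
  cases i with
  | none => exact le_rfl
  | some i => exact i.2.le

theorem indexNat_injective : Function.Injective (indexNat (s := s)) := by
  rintro (_ | i) (_ | j) h
  · rfl
  · exact absurd h j.2.ne'
  · exact absurd h i.2.ne
  · exact congrArg some (Fin.ext h)

theorem exists_indexNat {k : ℕ} (h : k ≤ s) : ∃ i : Option (Fin s), indexNat i = k := by
  rcases h.lt_or_eq with h | rfl
  · exact ⟨some ⟨k, h⟩, rfl⟩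
  · exact ⟨none, rfl⟩

/-- The vertices of the layered graph: core vertices and slots. -/
abbrev Vertex (L s : ℕ) : Type := (ZMod L × Option (Fin s)) ⊕ Slot L (Fin s)

/-- The label of a vertex. -/
def label : Vertex L s → Label
  | .inl (m, i) => (m.val, indexNat i, 4, 0)
  | .inr (m, i, r, j) => (m.val, indexNat i, r.toNat, indexNat j)

theorem Role.toNat_lt (r : Role) : r.toNat < 4 := by cases r <;> decide

theorem Role.toNat_injective : Function.Injective Role.toNat := by
  rintro (_ | _) (_ | _) h <;> first | rfl | simp [Role.toNat] at h

theorem Role.exists_toNat {k : ℕ} (h : k < 4) : ∃ r : Role, r.toNat = k := by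
  interval_cases k
  exacts [⟨.a, rfl⟩, ⟨.b, rfl⟩, ⟨.c, rfl⟩, ⟨.d, rfl⟩]

theorem label_injective [NeZero L] : Function.Injective (label (L := L) (s := s)) := by
  rintro (⟨m, i⟩ | ⟨m, i, r, j⟩) (⟨m', i'⟩ | ⟨m', i', r', j'⟩) h <;>
    simp only [label, Prod.mk.injEq] at h
  · rw [ZMod.val_injective L h.1, indexNat_injective h.2.1]
  · exact absurd h.2.2.1 r'.toNat_lt.ne'
  · exact absurd h.2.2.1 r.toNat_lt.ne
  · rw [ZMod.val_injective L h.1, indexNat_injective h.2.1, Role.toNat_injective h.2.2.1,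
      indexNat_injective h.2.2.2]

theorem mem_labels [NeZero L] {a : Label} : a ∈ labels s L ↔ ∃ v : Vertex L s, label v = a := by
  constructor
  · simp only [labels, List.mem_flatMap, List.mem_range, List.mem_cons, List.mem_map]
    rintro ⟨m, hm, i, hi, rfl | ⟨r, hr, j, hj, rfl⟩⟩
    · obtain ⟨i, rfl⟩ := exists_indexNat (Nat.le_of_lt_succ hi)
      exact ⟨.inl (m, i), by simp [label, ZMod.val_cast_of_lt hm]⟩
    · obtain ⟨i, rfl⟩ := exists_indexNat (Nat.le_of_lt_succ hi)
      obtain ⟨j, rfl⟩ := exists_indexNat (Nat.le_of_lt_succ hj)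
      obtain ⟨r, rfl⟩ := Role.exists_toNat hr
      exact ⟨.inr (m, i, r, j), by simp [label, ZMod.val_cast_of_lt hm]⟩
  · simp only [labels, List.mem_flatMap, List.mem_range, List.mem_cons, List.mem_map]
    rintro ⟨⟨m, i⟩ | ⟨m, i, r, j⟩, rfl⟩
    · exact ⟨m.val, ZMod.val_lt m, indexNat i, Nat.lt_succ_of_le (indexNat_le i), Or.inl rfl⟩
    · exact ⟨m.val, ZMod.val_lt m, indexNat i, Nat.lt_succ_of_le (indexNat_le i), Or.inr
        ⟨r.toNat, r.toNat_lt, indexNat j, Nat.lt_succ_of_le (indexNat_le j), rfl⟩⟩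

theorem length_labels : (labels s L).length = L * ((s + 1) * (1 + 4 * (s + 1))) := by
  simp [labels, List.length_flatMap]
  left
  ring

/-- The list of labels enumerates the vertices of the layered graph. -/
theorem exists_labels_equiv [NeZero L] : ∃ e : Fin (labels s L).length ≃ Vertex L s,
    ∀ i, label (e i) = (labels s L).get i := by
  choose e he using fun i : Fin (labels s L).length => mem_labels.1 ((labels s L).get_mem i)
  have hsurj : Function.Surjective e := fun v => by
    obtain ⟨i, hi⟩ := List.get_of_mem (mem_labels.2 ⟨v, rfl⟩ : label v ∈ labels s L)
    exact ⟨i, label_injective ((he i).trans hi)⟩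
  have : Fintype (ZMod L) := ZMod.fintype L
  refine ⟨Equiv.ofBijective e ((Fintype.bijective_iff_surjective_and_card e).2 ⟨hsurj, ?_⟩), he⟩
  have h4 : Fintype.card Role = 4 := rfl
  simp only [Fintype.card_fin, Fintype.card_sum, Fintype.card_prod, Fintype.card_option,
    ZMod.card, length_labels, h4]
  ring

theorem val_add_natCast_iff [NeZero L] {d : ℕ} (hd : d < L) (m m' : ZMod L) :
    (m.val + d = m'.val ∨ m.val + d = m'.val + L) ↔ m' = m + (d : ZMod L) := by
  have h := ZMod.val_lt m
  have h' := ZMod.val_lt m'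
  constructor
  · rintro (h | h)
    · have := congrArg (Nat.cast : ℕ → ZMod L) h
      simpa using this.symm
    · have := congrArg (Nat.cast : ℕ → ZMod L) h
      simpa using this.symm
  · rintro rfl
    rw [ZMod.val_add, ZMod.val_cast_of_lt hd] at *
    rcases lt_or_ge (m.val + d) L with h1 | h1
    · exact Or.inl (Nat.mod_eq_of_lt h1).symm
    · right
      rw [Nat.mod_eq_sub_mod h1, Nat.mod_eq_of_lt (by omega)]
      omega

/-- Reading the doubled list at `m + (L - 2)` amounts to reading the list at `m - 2` modulo `L`. -/
theorem getD_append_self (l : List (List (ℕ × Bool))) (hl : l.length = L) [NeZero L] (hL : 12 ≤ L)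
    (m : ZMod L) : (l ++ l).getD (m.val + (L - 2)) [] = l.getD (m - 2).val [] := by
  have h := ZMod.val_lt m
  have h' := ZMod.val_lt (m - 2)
  have h2 := (val_add_natCast_iff (d := 2) (by omega) (m - 2) m).2 (by push_cast; ring)
  rcases h2 with h2 | h2
  · rw [List.getD_append_right _ _ _ _ (by omega)]
    congr 1
    omega
  · rw [List.getD_append _ _ _ _ (by omega)]
    congr 1
    omega

/-- The clause of layer `m` contains the literal with sign `b` of the variable `(p, q)`. -/
def LayerLit (s L : ℕ) (cl : List (List (ℕ × Bool))) (m : ZMod L) (p q : Fin s) (b : Bool) : Prop :=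
  hasLit (cl.getD m.val []) (p * s + q) b = true

theorem link_label [NeZero L] {d r r' : ℕ} (hd : d < L) (m m' : ZMod L) (i i' : ℕ)
    (ρ ρ' : Role) (j j' : ℕ) :
    link L d r r' (m.val, i, ρ.toNat, j) (m'.val, i', ρ'.toNat, j') = true ↔
      (ρ.toNat = r ∧ ρ'.toNat = r') ∧ m' = m + (d : ZMod L) := by
  rw [← val_add_natCast_iff hd]
  simp [link]

/-- The directed edges between labels are those of the layered graph. -/
theorem arc_label_slot [NeZero L] [NeZero s] (hL : 12 ≤ L) {cl : List (List (ℕ × Bool))}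
    (hcl : cl.length = L) (u v : Slot L (Fin s)) :
    arc s L cl (label (.inr u)) (label (.inr v)) = true ↔
      Arc (0 : Fin s) (LayerLit s L cl) u v := by
  have k0 := fun r r' m m' i i' ρ ρ' j j' =>
    link_label (L := L) (d := 0) (r := r) (r' := r') (by omega) m m' i i' ρ ρ' j j'
  have k1 := fun r r' m m' i i' ρ ρ' j j' =>
    link_label (L := L) (d := 1) (r := r) (r' := r') (by omega) m m' i i' ρ ρ' j j'
  have k2 := fun r r' m m' i i' ρ ρ' j j' =>
    link_label (L := L) (d := 2) (r := r) (r' := r') (by omega) m m' i i' ρ ρ' j j'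
  have k3 := fun r r' m m' i i' ρ ρ' j j' =>
    link_label (L := L) (d := 3) (r := r) (r' := r') (by omega) m m' i i' ρ ρ' j j'
  have k5 := fun r r' m m' i i' ρ ρ' j j' =>
    link_label (L := L) (d := 5) (r := r) (r' := r') (by omega) m m' i i' ρ ρ' j j'
  have hz : ∀ i : Fin s, (i : ℕ) = 0 ↔ i = 0 := fun i => by
    rw [Fin.ext_iff]; rfl
  have hlt : ∀ i : Fin s, (i : ℕ) < s := fun i => i.2
  have hne : ∀ i : Fin s, (i : ℕ) ≠ s := fun i => i.2.ne
  have hne' : ∀ i : Fin s, s ≠ (i : ℕ) := fun i => i.2.ne'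
  have hs0 : s ≠ 0 := NeZero.ne s
  have hg := fun m => getD_append_self cl hcl hL m
  obtain ⟨m, i, r, j⟩ := u
  obtain ⟨m', i', r', j'⟩ := v
  simp only [label, arc, ownerArc, cycleArc, hubArc, hubHubArc, literalArc, Bool.or_eq_true,
    Bool.and_eq_true, beq_iff_eq, k0, k1, k2, k3, k5, hg]
  have hR : ∀ ρ ρ' : Role, ρ.toNat = ρ'.toNat ↔ ρ = ρ' := fun ρ ρ' => Role.toNat_injective.eq_iff
  have h0 : ∀ ρ : Role, ρ.toNat = 0 ↔ ρ = .a := fun ρ => hR ρ .a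
  have h1 : ∀ ρ : Role, ρ.toNat = 1 ↔ ρ = .b := fun ρ => hR ρ .b
  have h2 : ∀ ρ : Role, ρ.toNat = 2 ↔ ρ = .c := fun ρ => hR ρ .c
  have h3 : ∀ ρ : Role, ρ.toNat = 3 ↔ ρ = .d := fun ρ => hR ρ .d
  have h4 : ∀ ρ : Role, ρ.toNat ≠ 4 := fun ρ => ρ.toNat_lt.ne
  constructor
  · intro h
    rcases i with _ | i <;> rcases i' with _ | i' <;> rcases j with _ | j <;>
      rcases j' with _ | j' <;> simp only [indexNat_some, indexNat_none, hne, hne', hlt,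
      lt_irrefl, false_and, and_false, or_false, false_or, true_and, and_true, hs0,
      pos_iff_ne_zero, hz,
      ← Fin.ext_iff, ne_eq, h0, h1, h2, h3, h4, decide_true, decide_false, Bool.false_eq_true,
      decide_eq_true_eq, not_false_eq_true, Nat.cast_zero, Nat.cast_one, Nat.cast_ofNat,
      add_zero] at h
    all_goals
      casesm* _ ∧ _, _ ∨ _
      all_goals
        subst_vars
        constructor <;> first | rfl | assumption
  · intro h
    cases h <;> simp only [indexNat_some, indexNat_none, lt_irrefl, false_and, and_false, or_false,
      false_or, true_and, and_true, or_true, true_or, pos_iff_ne_zero, ← Fin.ext_iff, ne_eq,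
      decide_true, decide_false, Bool.false_eq_true, decide_eq_true_eq, not_true_eq_false,
      not_false_eq_true, Nat.cast_zero, Nat.cast_one, Nat.cast_ofNat, add_zero, reduceCtorEq, *] <;>
      simp_all [LayerLit]

/-- Adjacency in the layered graph is computed by `arc`. -/
theorem arc_label [NeZero L] [NeZero s] (hL : 12 ≤ L) {cl : List (List (ℕ × Bool))}
    (hcl : cl.length = L) (u v : Vertex L s) :
    (arc s L cl (label u) (label v) || arc s L cl (label v) (label u)) = true ↔
      (slotGraph owner (slotEdges (0 : Fin s) (LayerLit s L cl))).Adj u v := by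
  have core : ∀ (c : ZMod L × Option (Fin s)) (v : Vertex L s),
      arc s L cl (label (.inl c)) (label v) = false := fun c v => by
    simp [arc, ownerArc, cycleArc, hubArc, hubHubArc, literalArc, link, label]
  have own : ∀ (c : ZMod L × Option (Fin s)) (u : Slot L (Fin s)),
      arc s L cl (label (.inr u)) (label (.inl c)) = true ↔ owner u = c := by
    rintro ⟨m', i'⟩ ⟨m, i, r, j⟩
    simp [arc, ownerArc, cycleArc, hubArc, hubHubArc, literalArc, link, label, r.toNat_lt,
      (ZMod.val_injective L).eq_iff, indexNat_injective.eq_iff, owner]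
  rcases u with c | u <;> rcases v with c' | v
  · simp [core]
  · simp [core, own]
  · simp [core, own]
  · rw [Bool.or_eq_true, arc_label_slot hL hcl, arc_label_slot hL hcl, slotGraph_inr_inr]
    rfl

theorem enc_map {α β : Type} [Enc β] (l : List α) (f : α → β) :
    Enc.enc (l.map f) = Data.ofList (List.ofFn fun i : Fin l.length => Enc.enc (f (l.get i))) :=
  congrArg Data.ofList (List.ext_getElem (by simp) fun i h₁ h₂ => by simp)

theorem ofRat_eq_enc (e : ℕ) : Data.ofRat (((4 * (2 * 2 ^ e) + 4 : ℕ) : ℚ) / 2) =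
    Enc.enc (false, false :: true :: (2 ^ e).bits, [true]) := by
  have h : ((4 * (2 * 2 ^ e) + 4 : ℕ) : ℚ) / 2 = ((2 * (2 * 2 ^ e + 1) : ℕ) : ℚ) := by
    push_cast; ring
  rw [h, Data.ofRat]
  have h0 : ¬ (((2 * (2 * 2 ^ e + 1) : ℕ) : ℚ) < 0) := not_lt.2 (Nat.cast_nonneg _)
  rw [decide_eq_false h0, Rat.num_natCast, Rat.den_natCast, Int.natAbs_natCast]
  simp only [Data.ofBinary]
  rw [Nat.bit0_bits _ (by positivity), Nat.bit1_bits, Nat.one_bits]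
  rfl

/-- The constructed matrix and density encode an instance whose graph is the layered graph. -/
theorem exists_encodeInstance_eq [NeZero L] {e : ℕ} (hs : s = 2 * 2 ^ e) [NeZero s] (hL : 12 ≤ L)
    {cl : List (List (ℕ × Bool))} (hcl : cl.length = L) :
    ∃ (n : ℕ) (G : SimpleGraph (Fin n)),
      encodeInstance G (((4 * s + 4 : ℕ) : ℚ) / 2) =
        Enc.enc (matrix s L cl, false, false :: true :: (2 ^ e).bits, [true]) ∧
      Nonempty (G ≃g slotGraph owner (slotEdges (0 : Fin s) (LayerLit s L cl))) := by
  classical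
  obtain ⟨ε, hε⟩ := exists_labels_equiv (L := L) (s := s)
  refine ⟨_, (slotGraph owner (slotEdges (0 : Fin s) (LayerLit s L cl))).comap ε, ?_,
    ⟨SimpleGraph.Iso.comap ε _⟩⟩
  refine congrArg₂ Data.cons ?_ (hs ▸ ofRat_eq_enc e)
  simp only [matrix, enc_map]
  congr 2
  funext i
  congr 2
  funext j
  refine congrArg Data.ofBool (Bool.eq_iff_iff.2 ?_)
  rw [decide_eq_true_iff, SimpleGraph.comap_adj, ← arc_label hL hcl, hε, hε]

end Bridge
/-! ### Dense minors and satisfying assignments -/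

theorem hasLit_iff {C : List (ℕ × Bool)} {x : ℕ} {b : Bool} : hasLit C x b = true ↔ (x, b) ∈ C := by
  simp only [hasLit, List.any_eq_true, Bool.and_eq_true, beq_iff_eq]
  constructor
  · rintro ⟨⟨x', b'⟩, h, rfl, rfl⟩
    exact h
  · exact fun h => ⟨_, h, rfl, rfl⟩

section Layers

variable {cls : List (List (ℕ × Bool))}

theorem layerClauses_cons (C : List (ℕ × Bool)) :
    layerClauses (C :: cls) = C :: [(0, true), (0, false)] :: layerClauses cls := rfl

theorem length_layerClauses : (layerClauses cls).length = 2 * cls.length + 12 := by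
  induction cls with
  | nil => rfl
  | cons C cls ih => simp only [layerClauses_cons, List.length_cons, ih]; ring

theorem layerClauses_getD {k : ℕ} (hk : k < (layerClauses cls).length) :
    (k % 2 = 0 ∧ (layerClauses cls).getD k [] ∈ cls) ∨
      (layerClauses cls).getD k [] = [(0, true), (0, false)] := by
  induction cls generalizing k with
  | nil => exact Or.inr (List.getD_replicate _ hk)
  | cons C cls ih =>
    rw [layerClauses_cons] at hk ⊢
    match k, hk with
    | 0, _ => exact Or.inl ⟨rfl, by simp⟩
    | 1, _ => exact Or.inr rfl
    | k + 2, hk =>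
      simp only [List.getD_cons_succ, List.length_cons, List.mem_cons] at hk ⊢
      rcases ih (by omega : k < _) with h | h
      · exact Or.inl ⟨by omega, Or.inr h.2⟩
      · exact Or.inr h

theorem exists_layerClauses_getD {C : List (ℕ × Bool)} (h : C ∈ cls) :
    ∃ k, 2 * k < (layerClauses cls).length ∧ (layerClauses cls).getD (2 * k) [] = C := by
  induction cls with
  | nil => simp at h
  | cons C' cls ih =>
    rw [layerClauses_cons]
    rcases List.mem_cons.1 h with rfl | h
    · exact ⟨0, by simp, rfl⟩
    · obtain ⟨k, hk, hk'⟩ := ih h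
      exact ⟨k + 1, by simp only [List.length_cons]; omega, by
        rw [show 2 * (k + 1) = 2 * k + 1 + 1 by ring]
        simpa using hk'⟩

end Layers

/-- The clauses of a formula, with variables as natural numbers. -/
def CNF.clauses {n : ℕ} (φ : CNF n) : List (List (ℕ × Bool)) :=
  φ.map fun C => C.map fun l => ((l.1 : ℕ), l.2)

section Equivalence

variable {n s L : ℕ} {φ : CNF n}

theorem CNF.mem_clauses {C' : List (ℕ × Bool)} :
    C' ∈ φ.clauses ↔ ∃ C ∈ φ, C.map (fun l => ((l.1 : ℕ), l.2)) = C' := by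
  simp [CNF.clauses]

/-- The variable `x` corresponds to the pair of its digits to the base `s`. -/
theorem exists_digits [NeZero s] {x : ℕ} (h : x < s * s) : ∃ p q : Fin s, (p : ℕ) * s + q = x :=
  ⟨⟨x / s, Nat.div_lt_of_lt_mul h⟩, ⟨x % s, Nat.mod_lt _ (NeZero.pos s)⟩, Nat.div_add_mod' x s⟩

theorem satisfiable_of_hasDenseHalfSTM [NeZero L] [NeZero s] (hn : n ≤ s * s)
    (hL : L = (layerClauses φ.clauses).length)
    (h : HasDenseHalfSTM 2 (slotGraph owner (slotEdges (0 : Fin s)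
      (LayerLit s L (layerClauses φ.clauses)))) (((4 * s + 4 : ℕ) : ℚ) / 2)) :
    φ.Satisfiable := by
  classical
  have h' := exists_consistent_of_hasDenseHalfSTM (L := L) (I := Fin s) (z := 0)
    (Lit := LayerLit s L (layerClauses φ.clauses)) (by rw [Fintype.card_fin]; exact h)
  obtain ⟨y, hy, hlit⟩ := h'
  have hstep : ∀ (k : ℕ) m p q, y m p q → y (m + ((2 * k : ℕ) : ZMod L)) p q := by
    intro k
    induction k with
    | zero => intro m p q h; simpa using h
    | succ k ih =>
      intro m p q h
      have := hy _ _ _ (hy _ _ _ (ih m p q h))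
      convert this using 1
      push_cast
      ring
  have hlen := length_layerClauses (cls := φ.clauses)
  -- All even layers carry the same values, as the number of layers is even.
  have heven : ∀ (k : ℕ) p q, 2 * k < L → (y ((2 * k : ℕ) : ZMod L) p q ↔ y 0 p q) := by
    refine fun k p q hk => ⟨fun h => ?_, fun h => by simpa using hstep k 0 p q h⟩
    have := hstep (φ.clauses.length + 6 - k) _ p q h
    rwa [← Nat.cast_add, show 2 * k + 2 * (φ.clauses.length + 6 - k) = L by omega,
      ZMod.natCast_self] at this
  choose P Q hPQ using fun i : Fin n => exists_digits (s := s) (i.2.trans_le hn)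
  have hs := NeZero.pos s
  refine ⟨fun i => decide (¬ y 0 (P i) (Q i)), fun C hC => ?_⟩
  obtain ⟨k, hk, hk'⟩ := exists_layerClauses_getD (CNF.mem_clauses.2 ⟨C, hC, rfl⟩)
  rw [← hL] at hk
  obtain ⟨p, q, hpq⟩ := hlit ((2 * k : ℕ) : ZMod L)
  rw [heven k p q hk] at hpq
  have key : ∀ b, LayerLit s L (layerClauses φ.clauses) ((2 * k : ℕ) : ZMod L) p q b →
      ∃ l ∈ C, P l.1 = p ∧ Q l.1 = q ∧ l.2 = b := fun b hb => by
    rw [LayerLit, ZMod.val_cast_of_lt hk, hk', hasLit_iff, List.mem_map] at hb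
    obtain ⟨l, hl, hlb⟩ := hb
    obtain ⟨h1, h2⟩ := Prod.mk.inj hlb
    have h3 := (hPQ l.1).trans h1
    have hq : Q l.1 = q := Fin.ext (by
      have := congrArg (· % s) h3
      simpa [Nat.mod_eq_of_lt (Q l.1).2, Nat.mod_eq_of_lt q.2] using this)
    refine ⟨l, hl, Fin.ext ?_, hq, h2⟩
    rw [hq] at h3
    exact Nat.eq_of_mul_eq_mul_right hs (Nat.add_right_cancel h3)
  rcases hpq with ⟨hb, hy'⟩ | ⟨hb, hy'⟩
  · obtain ⟨l, hl, rfl, rfl, hb'⟩ := key _ hb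
    exact ⟨l, hl, by simpa [hb'] using hy'⟩
  · obtain ⟨l, hl, rfl, rfl, hb'⟩ := key _ hb
    exact ⟨l, hl, by simpa [hb'] using hy'⟩

theorem hasDenseHalfSTM_of_satisfiable [NeZero L] [NeZero s] (hn : n ≤ s * s)
    (hL : L = (layerClauses φ.clauses).length) (h : φ.Satisfiable) :
    HasDenseHalfSTM 2 (slotGraph owner (slotEdges (0 : Fin s)
      (LayerLit s L (layerClauses φ.clauses)))) (((4 * s + 4 : ℕ) : ℚ) / 2) := by
  obtain ⟨a, ha⟩ := h
  have hlen := length_layerClauses (cls := φ.clauses)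
  let a' : Fin s → Fin s → Bool := fun p q =>
    if h : (p : ℕ) * s + q < n then a ⟨p * s + q, h⟩ else true
  let y : ZMod L → Fin s → Fin s → Bool := fun m p q =>
    if m.val % 2 = 0 then !a' p q else !a' q p
  suffices h : HasDenseHalfSTM 2 (slotGraph owner (slotEdges (0 : Fin s)
      (LayerLit s L (layerClauses φ.clauses)))) (((4 * Fintype.card (Fin s) + 4 : ℕ) : ℚ) / 2) by
    rwa [Fintype.card_fin] at h
  refine hasDenseHalfSTM_of_consistent (y := y) (by omega) (fun m p q hy => ?_) fun m => ?_
  · have h1 := (val_add_natCast_iff (L := L) (d := 1) (by omega) m (m + 1)).2 (by simp)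
    simp only [y] at hy ⊢
    by_cases hm : m.val % 2 = 0
    · rw [if_pos hm] at hy
      rwa [if_neg (by omega)]
    · rw [if_neg hm] at hy
      rwa [if_pos (by omega)]
  · rcases layerClauses_getD (hL ▸ ZMod.val_lt m : m.val < (layerClauses φ.clauses).length) with
      ⟨hm, h⟩ | h
    · obtain ⟨C, hC, hC'⟩ := CNF.mem_clauses.1 h
      obtain ⟨l, hl, hal⟩ := ha C hC
      obtain ⟨p, q, hpq⟩ := exists_digits (s := s) (l.1.2.trans_le hn)
      refine ⟨p, q, l.2, ?_, ?_⟩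
      · rw [LayerLit, hasLit_iff, ← hC', hpq]
        exact List.mem_map_of_mem (f := fun l : Fin n × Bool => ((l.1 : ℕ), l.2)) hl
      · simp only [y, a', hm, if_true, hpq, l.1.2, dif_pos, Fin.eta, hal]
    · refine ⟨0, 0, !y m 0 0, ?_, by simp⟩
      rw [LayerLit, hasLit_iff, h]
      cases y m 0 0 <;> simp

end Equivalence
/-! ### Path decompositions and the treewidth of the layered graph -/

theorem pathGraph_isTree (n : ℕ) : (SimpleGraph.pathGraph (n + 1)).IsTree := by
  refine ⟨SimpleGraph.pathGraph_connected n, ?_⟩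
  rw [SimpleGraph.isAcyclic_iff_forall_adj_isBridge]
  -- Removing the edge between `u` and `u + 1` separates the vertices up to `u` from the others.
  have key : ∀ u v : Fin (n + 1), u.val + 1 = v.val →
      ¬ ((SimpleGraph.pathGraph (n + 1)).deleteEdges {s(u, v)}).Reachable u v := by
    rintro u v huv ⟨p⟩
    have hle : ∀ {a b : Fin (n + 1)}, ((SimpleGraph.pathGraph (n + 1)).deleteEdges
        {s(u, v)}).Walk a b → a ≤ u → b ≤ u := by
      intro a b p
      induction p with
      | nil => exact fun h => h
      | @cons a b c h _ ih =>
        refine fun ha => ih ?_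
        rw [SimpleGraph.deleteEdges_adj, SimpleGraph.pathGraph_adj] at h
        by_contra hb
        have hau : a = u := by rw [Fin.ext_iff]; rw [Fin.le_def] at ha hb; omega
        have hbv : b = v := by rw [Fin.ext_iff]; rw [Fin.le_def] at ha hb; omega
        exact h.2 (by rw [hau, hbv]; rfl)
    have := hle p le_rfl
    rw [Fin.le_def] at this
    omega
  intro u v h
  rw [SimpleGraph.isBridge_iff]
  rcases SimpleGraph.pathGraph_adj.1 h with h' | h'
  · exact key u v h'
  · rw [Sym2.eq_swap]
    exact fun hr => key v u h' hr.symm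

theorem pathGraph_induce_preconnected {n : ℕ} {S : Set (Fin n)} (hS : S.OrdConnected) :
    ((SimpleGraph.pathGraph n).induce S).Preconnected := by
  have key : ∀ (k : ℕ) (a b : S), (a : Fin n).val + k = (b : Fin n).val →
      ((SimpleGraph.pathGraph n).induce S).Reachable a b := by
    intro k
    induction k with
    | zero =>
      intro a b h
      rw [show a = b from Subtype.ext (Fin.ext h)]
    | succ k ih =>
      intro a b h
      have hc : (⟨(a : Fin n).val + k, by have := (b : Fin n).2; omega⟩ : Fin n) ∈ S :=
        hS.out a.2 b.2 ⟨by rw [Fin.le_def]; simp, by rw [Fin.le_def]; simp only; omega⟩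
      refine (ih a ⟨_, hc⟩ rfl).trans (SimpleGraph.Adj.reachable ?_)
      rw [SimpleGraph.induce_adj, SimpleGraph.pathGraph_adj]
      left
      simp only
      omega
  intro a b
  rcases le_total (a : Fin n).val (b : Fin n).val with h | h
  · exact key _ a b (Nat.add_sub_cancel' h)
  · exact (key _ b a (Nat.add_sub_cancel' h)).symm

/-- A bound for the treewidth from a path decomposition: at every time `t ≤ n` a set of vertices is
present, and every vertex is present in an interval of time. -/
theorem treewidth_le_of_path {V V' : Type} [Finite V] {G : SimpleGraph V} {G' : SimpleGraph V'}
    (φ : G ≃g G') (n w : ℕ) (present : V' → Set ℕ) (hint : ∀ v, (present v).OrdConnected)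
    (hmem : ∀ v, ∃ t ≤ n, t ∈ present v)
    (hadj : ∀ u v, G'.Adj u v → ∃ t ≤ n, t ∈ present u ∧ t ∈ present v)
    (hcard : ∀ t, {v | t ∈ present v}.ncard ≤ w + 1) : treewidth G ≤ w := by
  refine Nat.sInf_le ⟨Fin (n + 1), inferInstance,
    { tree := SimpleGraph.pathGraph (n + 1)
      isTree := pathGraph_isTree n
      bag := fun t => {v | t.val ∈ present (φ v)}
      exists_mem_bag := fun v => ?_
      exists_edge_bag := fun u v h => ?_
      preconnected := fun v => pathGraph_induce_preconnected ⟨fun a ha b hb c hc => ?_⟩ },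
    fun t => ?_⟩
  · obtain ⟨t, ht, h⟩ := hmem (φ v)
    exact ⟨⟨t, Nat.lt_succ_of_le ht⟩, h⟩
  · obtain ⟨t, ht, h1, h2⟩ := hadj (φ u) (φ v) (φ.map_rel_iff.2 h)
    exact ⟨⟨t, Nat.lt_succ_of_le ht⟩, h1, h2⟩
  · exact (hint (φ v)).out ha hb hc
  · refine le_trans (le_of_eq ?_) (hcard t)
    exact Set.ncard_preimage_of_injective_subset_range (s := {v | t.val ∈ present v}) φ.injective
      (by rw [φ.surjective.range_eq]; exact Set.subset_univ _)

section LayeredTreewidth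

variable {s L : ℕ}

/-- The distance between the layer of a cycle and the layer of its slots of a given role. -/
def Role.shift : Role → ℕ
  | .a => 0
  | .b => 1
  | .c => 2
  | .d => 5

/-- The number of the pair of indices that determines, together with the layer, the cycle of a
slot. -/
def cycleCode : Role → Fin s → Fin s → ℕ
  | .a, i, j => i * s + j
  | .b, i, j => j * s + i
  | .c, i, j => i * s + j
  | .d, i, j => j * s + i

/-- The times at which the vertices of layer `m` outside of the cycles are present. Every layer is
processed for `s ^ 2` units of time, and the first five layers are always present since they are
adjacent to the last ones. -/
def layerTimes (s : ℕ) (m : ZMod L) : Set ℕ :=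
  {t | m.val < 5 ∨ t / (s * s) ≤ m.val ∧ m.val ≤ t / (s * s) + 5}

/-- The times at which a vertex is present in the path decomposition. The slots of every cycle are
present only at a time of their own. -/
def presentAt : Vertex L s → Set ℕ
  | .inl (m, _) => layerTimes s m
  | .inr (m, some i, r, some j) =>
      {s * s * (m - (r.shift : ZMod L)).val + cycleCode r i j}
  | .inr (m, none, _, _) => layerTimes s m
  | .inr (m, some _, _, none) => layerTimes s m

theorem layerTimes_ordConnected (m : ZMod L) : (layerTimes s m).OrdConnected := by
  refine ⟨fun a ha b hb c hc => ?_⟩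
  have h1 : a / (s * s) ≤ c / (s * s) := Nat.div_le_div_right hc.1
  have h2 : c / (s * s) ≤ b / (s * s) := Nat.div_le_div_right hc.2
  simp only [layerTimes, Set.mem_ofPred_eq] at *
  omega

theorem presentAt_ordConnected (v : Vertex L s) : (presentAt v).OrdConnected := by
  rcases v with ⟨m, i⟩ | ⟨m, i | i, r, j | j⟩
  exacts [layerTimes_ordConnected m, layerTimes_ordConnected m, layerTimes_ordConnected m,
    layerTimes_ordConnected m, Set.ordConnected_singleton]

theorem mul_add_lt_mul_self (i j : Fin s) : (i : ℕ) * s + j < s * s := by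
  have h1 : ((i : ℕ) + 1) * s ≤ s * s := Nat.mul_le_mul_right _ i.2
  have h2 := j.2
  rw [Nat.succ_mul] at h1
  omega

theorem cycleCode_lt (r : Role) (i j : Fin s) : cycleCode r i j < s * s := by
  cases r <;> exact mul_add_lt_mul_self _ _

theorem mul_self_pos [NeZero s] : 0 < s * s := Nat.mul_pos (NeZero.pos s) (NeZero.pos s)

/-- The vertices up to five layers after the layer `m` are present while `m` is processed. -/
theorem mem_layerTimes [NeZero s] [NeZero L] (hL : 12 ≤ L) {m m' : ZMod L} {d c : ℕ} (hd : d ≤ 5)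
    (hm : m' = m + (d : ZMod L)) (hc : c < s * s) : s * s * m.val + c ∈ layerTimes s m' := by
  have h := (val_add_natCast_iff (L := L) (by omega) m m').2 hm
  have h' := ZMod.val_lt m
  rw [layerTimes, Set.mem_ofPred_eq, Nat.mul_add_div mul_self_pos, Nat.div_eq_of_lt hc]
  omega

theorem le_of_cycleTime [NeZero s] [NeZero L] {m : ZMod L} {c : ℕ} (hc : c < s * s) :
    s * s * m.val + c ≤ s * s * L := by
  have h : s * s * (m.val + 1) ≤ s * s * L := Nat.mul_le_mul_left _ (ZMod.val_lt m)
  rw [Nat.mul_succ] at h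
  omega

/-- Adjacent slots are present at a common time. -/
theorem exists_presentAt_of_arc [NeZero s] [NeZero L] (hL : 12 ≤ L)
    {Lit : ZMod L → Fin s → Fin s → Bool → Prop} {u v : Slot L (Fin s)} (h : Arc 0 Lit u v) :
    ∃ t ≤ s * s * L, t ∈ presentAt (.inr u) ∧ t ∈ presentAt (.inr v) := by
  have fat : ∀ (m m' : ZMod L) (d : ℕ), d ≤ 5 → m' = m + (d : ZMod L) →
      ∃ t ≤ s * s * L, t ∈ layerTimes s m ∧ t ∈ layerTimes s m' := fun m m' d hd hm =>
    ⟨s * s * m.val + 0, le_of_cycleTime mul_self_pos,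
      mem_layerTimes hL (d := 0) (by omega) (by simp) mul_self_pos,
      mem_layerTimes hL hd hm mul_self_pos⟩
  have thin : ∀ (m : ZMod L) (i j : Fin s) (r : Role), ∃ t ≤ s * s * L,
      t = s * s * m.val + cycleCode r i j :=
    fun m i j r => ⟨_, le_of_cycleTime (cycleCode_lt r i j), rfl⟩
  cases h
  case cycle_ab m m' i j hm =>
    obtain ⟨t, ht, rfl⟩ := thin m i j .a
    refine ⟨_, ht, ?_, ?_⟩ <;> simp [presentAt, Role.shift, cycleCode, hm]
  case cycle_bc m m' i j hm =>
    obtain ⟨t, ht, rfl⟩ := thin (m - 1) i j .b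
    refine ⟨_, ht, ?_, ?_⟩ <;> simp [presentAt, Role.shift, cycleCode, hm]
    left
    congr 1
    ring
  case cycle_cd m m' i j hm =>
    obtain ⟨t, ht, rfl⟩ := thin (m - 2) i j .c
    refine ⟨_, ht, ?_, ?_⟩ <;> simp [presentAt, Role.shift, cycleCode, hm]
    left
    congr 1
    ring
  case cycle_ad m m' i j hm =>
    obtain ⟨t, ht, rfl⟩ := thin m i j .a
    refine ⟨_, ht, ?_, ?_⟩ <;> simp [presentAt, Role.shift, cycleCode, hm]
  all_goals first
    | (apply fat _ _ 0 (by omega); simp; done)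
    | (apply fat _ _ 1 (by omega); simpa)
    | (apply fat _ _ 2 (by omega); simpa)
    | (apply fat _ _ 3 (by omega); simpa)
    | (apply fat _ _ 5 (by omega); simpa)

theorem exists_presentAt_owner [NeZero s] [NeZero L] (hL : 12 ≤ L) (u : Slot L (Fin s)) :
    ∃ t ≤ s * s * L, t ∈ presentAt (.inl (owner u)) ∧ t ∈ presentAt (.inr u) := by
  have fat : ∀ (m : ZMod L), ∃ t ≤ s * s * L, t ∈ layerTimes s m ∧ t ∈ layerTimes s m := fun m =>
    have h := mem_layerTimes (s := s) (m := m) (m' := m) hL (d := 0) (by omega) (by simp)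
      mul_self_pos
    ⟨s * s * m.val + 0, le_of_cycleTime mul_self_pos, h, h⟩
  rcases u with ⟨m, i | i, r, j | j⟩
  · exact fat m
  · exact fat m
  · exact fat m
  · refine ⟨_, le_of_cycleTime (cycleCode_lt r i j), ?_, rfl⟩
    exact mem_layerTimes hL (d := r.shift) (by cases r <;> decide) (by simp) (cycleCode_lt r i j)

/-- An enumeration of the vertices that are present at time `t`. -/
def presentVertex [NeZero s] (L t : ℕ) :
    (Fin 11 × (Option (Fin s) ⊕ (Role × Option (Fin s)) ⊕ (Role × Option (Fin s)))) ⊕ Role →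
      Vertex L s
  | .inl (k, x) =>
      let m : ZMod L := ((if k.val < 5 then k.val else t / (s * s) + (k.val - 5) : ℕ) : ZMod L)
      match x with
      | .inl i => .inl (m, i)
      | .inr (.inl (r, j)) => .inr (m, none, r, j)
      | .inr (.inr (r, i)) => .inr (m, i, r, none)
  | .inr r =>
      let p : Fin s := Fin.ofNat s (t % (s * s) / s)
      let q : Fin s := Fin.ofNat s (t % (s * s) % s)
      let m : ZMod L := ((t / (s * s) : ℕ) : ZMod L) + (r.shift : ZMod L)
      match r with
      | .a => .inr (m, some p, .a, some q)
      | .b => .inr (m, some q, .b, some p)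
      | .c => .inr (m, some p, .c, some q)
      | .d => .inr (m, some q, .d, some p)

theorem exists_presentVertex [NeZero s] [NeZero L] {t : ℕ} {v : Vertex L s} (h : t ∈ presentAt v) :
    ∃ x, presentVertex L t x = v := by
  have fat : ∀ m : ZMod L, t ∈ layerTimes s m → ∃ k : Fin 11,
      ((if k.val < 5 then k.val else t / (s * s) + (k.val - 5) : ℕ) : ZMod L) = m := by
    intro m hm
    rcases lt_or_ge m.val 5 with h5 | h5
    · exact ⟨⟨m.val, by omega⟩, by simp [h5]⟩
    · rcases hm with hm | hm
      · omega
      · refine ⟨⟨m.val - t / (s * s) + 5, by omega⟩, ?_⟩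
        rw [if_neg (by simp), show t / (s * s) + (m.val - t / (s * s) + 5 - 5) = m.val by omega]
        simp
  have code : ∀ i j : Fin s, Fin.ofNat s (((i : ℕ) * s + j) / s) = i ∧
      Fin.ofNat s (((i : ℕ) * s + j) % s) = j := fun i j => by
    rw [mul_comm, Nat.mul_add_div (NeZero.pos s), Nat.div_eq_of_lt j.2, Nat.mul_add_mod,
      Nat.mod_eq_of_lt j.2]
    simp [Fin.ofNat, Nat.mod_eq_of_lt i.2, Nat.mod_eq_of_lt j.2]
  rcases v with ⟨m, i⟩ | ⟨m, i | i, r, j | j⟩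
  · obtain ⟨k, hk⟩ := fat m h
    exact ⟨.inl (k, .inl i), by simp only [presentVertex, hk]⟩
  · obtain ⟨k, hk⟩ := fat m h
    exact ⟨.inl (k, .inr (.inl (r, none))), by simp only [presentVertex, hk]⟩
  · obtain ⟨k, hk⟩ := fat m h
    exact ⟨.inl (k, .inr (.inl (r, some j))), by simp only [presentVertex, hk]⟩
  · obtain ⟨k, hk⟩ := fat m h
    exact ⟨.inl (k, .inr (.inr (r, some i))), by simp only [presentVertex, hk]⟩
  · obtain rfl : t = _ := h
    refine ⟨.inr r, ?_⟩
    have hc := cycleCode_lt r i j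
    have h1 := (code i j).1
    have h2 := (code i j).2
    have h3 := (code j i).1
    have h4 := (code j i).2
    cases r <;> simp only [presentVertex, Nat.mul_add_div mul_self_pos, Nat.div_eq_of_lt hc,
      Nat.mul_add_mod, Nat.mod_eq_of_lt hc] <;> simp only [cycleCode, h1, h2, h3, h4] <;> simp

/-- The treewidth of the layered graph is linear in the number of indices. -/
theorem treewidth_le_of_iso_slotGraph [NeZero s] [NeZero L] (hL : 12 ≤ L) {n : ℕ}
    {G : SimpleGraph (Fin n)} {Lit : ZMod L → Fin s → Fin s → Bool → Prop}
    (φ : G ≃g slotGraph owner (slotEdges 0 Lit)) : treewidth G ≤ 201 * s := by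
  have hs := NeZero.pos s
  refine treewidth_le_of_path φ (s * s * L) (201 * s) presentAt presentAt_ordConnected ?_ ?_ ?_
  · rintro (⟨m, i⟩ | u)
    · obtain ⟨t, ht, h, -⟩ := exists_presentAt_owner hL ((m, i, .a, none) : Slot L (Fin s))
      exact ⟨t, ht, h⟩
    · obtain ⟨t, ht, -, h⟩ := exists_presentAt_owner hL u
      exact ⟨t, ht, h⟩
  · rintro (c | u) (c' | v) h
    · exact absurd h (slotGraph_inl_inl _ _)
    · obtain rfl := (slotGraph_inl_inr _ _).1 h
      exact exists_presentAt_owner hL v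
    · obtain rfl := (slotGraph_inr_inl _ _).1 h
      obtain ⟨t, ht, h, h'⟩ := exists_presentAt_owner hL u
      exact ⟨t, ht, h', h⟩
    · rcases (slotGraph_inr_inr _ _).1 h with h | h
      · exact exists_presentAt_of_arc hL h
      · obtain ⟨t, ht, h, h'⟩ := exists_presentAt_of_arc hL h
        exact ⟨t, ht, h', h⟩
  · intro t
    have hsub : {v : Vertex L s | t ∈ presentAt v} ⊆ Set.range (presentVertex L t) :=
      fun v hv => exists_presentVertex hv
    refine (Set.ncard_le_ncard hsub (Set.finite_range _)).trans ?_
    rw [← Set.image_univ]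
    refine (Set.ncard_image_le Set.finite_univ).trans ?_
    have h4 : Fintype.card Role = 4 := rfl
    rw [Set.ncard_univ, Nat.card_eq_fintype_card]
    simp only [Fintype.card_sum, Fintype.card_prod, Fintype.card_fin, Fintype.card_option, h4]
    omega

end LayeredTreewidth
/-! ### The lower bound -/

theorem CNF.encode_eq_enc {n : ℕ} (φ : CNF n) : φ.encode = Enc.enc (n, φ.clauses) := by
  refine congrArg (Data.cons _) (congrArg Data.ofList ?_)
  rw [CNF.clauses, List.map_map]
  refine List.map_congr_left fun C _ => congrArg Data.ofList ?_
  rw [List.map_map]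
  rfl

/-- Formulas with clauses of bounded size have encodings of polynomial size. -/
theorem CNF.esize_le {n : ℕ} {φ : CNF n} (hφ : φ.IsThreeCNF) :
    esize (n, φ.clauses) + 1 ≤ 20 * (n + φ.length + 1) ^ 2 := by
  have h1 : ∀ C' ∈ φ.clauses, esize C' ≤ 3 * (2 * n + 6) + 1 := fun C' hC' => by
    obtain ⟨C, hC, rfl⟩ := CNF.mem_clauses.1 hC'
    refine (esize_le_of_forall (B := 2 * n + 5) fun l hl => ?_).trans ?_
    · obtain ⟨x, -, rfl⟩ := List.mem_map.1 hl
      have hx := x.1.2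
      have hb := esize_bool_le x.2
      rw [esize_pair, esize_nat]
      omega
    · rw [List.length_map]
      exact Nat.add_le_add_right (Nat.mul_le_mul_right _ (hφ C hC)) 1
  have h2 := esize_le_of_forall h1
  rw [show φ.clauses.length = φ.length from List.length_map _] at h2
  rw [esize_pair, esize_nat]
  nlinarith [Nat.zero_le (n * φ.length), Nat.zero_le (n * n)]

/-- The reduction yields an instance of Dense 1-Shallow Topological Minor that is equivalent to the
satisfiability of the formula, and whose graph has treewidth of the order of the square root of the
number of variables. -/
theorem exists_instance {n : ℕ} (φ : CNF n) : ∃ (N : ℕ) (G : SimpleGraph (Fin N)) (d : ℚ),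
    encodeInstance G d = Enc.enc (reduction (n, φ.clauses)) ∧
      (HasDenseHalfSTM 2 G d ↔ φ.Satisfiable) ∧
      treewidth G ^ 2 ≤ 201 ^ 2 * (4 * n + 4) := by
  obtain ⟨e, he, hs, hn⟩ := scale_spec n
  have : NeZero (2 * 2 ^ e) := ⟨by positivity⟩
  obtain ⟨L, hL⟩ : ∃ L, L = (layerClauses φ.clauses).length := ⟨_, rfl⟩
  have hL12 : 12 ≤ L := by rw [hL, length_layerClauses]; omega
  have : NeZero L := ⟨by omega⟩
  obtain ⟨N, G, hG, ⟨ψ⟩⟩ := exists_encodeInstance_eq (s := 2 * 2 ^ e) rfl hL12 hL.symm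
  refine ⟨N, G, ((4 * (2 * 2 ^ e) + 4 : ℕ) : ℚ) / 2, ?_, ⟨fun h => ?_, fun h => ?_⟩, ?_⟩
  · rw [hG, reduction, he, ← hL]
  · exact satisfiable_of_hasDenseHalfSTM hn hL (h.of_iso ψ)
  · exact (hasDenseHalfSTM_of_satisfiable hn hL h).of_iso ψ.symm
  · have h := Nat.pow_le_pow_left (treewidth_le_of_iso_slotGraph hL12 ψ) 2
    rw [mul_pow, pow_two (2 * 2 ^ e)] at h
    exact h.trans (Nat.mul_le_mul_left _ hs)

theorem exists_le_of_isLittleO {f : ℕ → ℝ} (hf : f =o[atTop] fun t : ℕ => (t : ℝ) ^ 2) {ε : ℝ}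
    (hε : 0 < ε) : ∃ C, 0 ≤ C ∧ ∀ t, f t ≤ ε * (t : ℝ) ^ 2 + C := by
  obtain ⟨N, hN⟩ := eventually_atTop.1 (hf.bound hε)
  refine ⟨∑ t ∈ Finset.range N, |f t|, Finset.sum_nonneg fun _ _ => abs_nonneg _, fun t => ?_⟩
  have h0 : 0 ≤ ∑ t ∈ Finset.range N, |f t| := Finset.sum_nonneg fun _ _ => abs_nonneg _
  rcases lt_or_ge t N with h | h
  · have h1 : |f t| ≤ ∑ t ∈ Finset.range N, |f t| :=
      Finset.single_le_sum (f := fun t => |f t|) (fun _ _ => abs_nonneg _) (Finset.mem_range.2 h)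
    have h2 : 0 ≤ ε * (t : ℝ) ^ 2 := by positivity
    linarith [le_abs_self (f t)]
  · have h1 := hN t h
    rw [Real.norm_eq_abs, Real.norm_of_nonneg (by positivity)] at h1
    linarith [le_abs_self (f t)]

/-- The reduction, followed by a subexponential algorithm for the constructed instance, solves 3SAT
too fast. -/
theorem not_decides_of_eth (h : ETH) (p : Prog) : ¬ DecidesDenseOneSTMSubexponentially p := by
  obtain ⟨δ, hδ, hno⟩ := h
  rintro ⟨f, K, c, hf, hp⟩
  refine hno ?_
  obtain ⟨⟨c₁, hc₁⟩, r, -, T, -, ⟨c₂, hc₂⟩, hr⟩ := PolyTime.reduction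
  -- The exponent `ε t ^ 2` for the treewidth `t` of the constructed graph is at most `δ (n + 1)`.
  obtain ⟨C, hC, hfC⟩ := exists_le_of_isLittleO hf (ε := δ / (4 * 201 ^ 2)) (by positivity)
  refine ⟨r.seq p, 20 ^ c₂ + |K| * (2 : ℝ) ^ (δ + C) * 20 ^ (c₁ * c), 2 * c₂ + 2 * (c₁ * c),
    fun n φ hφ => ?_⟩
  obtain ⟨N, G, d, hG, hsat, htw⟩ := exists_instance φ
  obtain ⟨s', t₂, hexec, ht₂, hs'⟩ := hp N G d
  obtain ⟨t₁, ht₁, hexec₁⟩ := hr (n, φ.clauses)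
  rw [← CNF.encode_eq_enc, ← hG] at hexec₁
  refine ⟨s', t₁ + t₂, Exec.seq hexec₁ hexec, ?_, hs'.trans hsat⟩
  obtain ⟨X, hX⟩ : ∃ X : ℝ, X = (n : ℝ) + (φ.length : ℝ) + 1 := ⟨_, rfl⟩
  have hX1 : 1 ≤ X := by
    rw [hX]
    linarith [Nat.cast_nonneg (α := ℝ) n, Nat.cast_nonneg (α := ℝ) φ.length]
  have hsize : (esize (n, φ.clauses) : ℝ) + 1 ≤ 20 * X ^ 2 := by
    rw [hX]
    exact_mod_cast CNF.esize_le hφ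
  have h₁ : (t₁ : ℝ) ≤ 20 ^ c₂ * X ^ (2 * c₂) := by
    have h : (t₁ : ℝ) ≤ ((esize (n, φ.clauses) : ℝ) + 1) ^ c₂ := by
      exact_mod_cast ht₁.trans (hc₂ _)
    refine h.trans ((pow_le_pow_left₀ (by positivity) hsize _).trans_eq ?_)
    rw [mul_pow, pow_mul]
  have hsize₂ : ((encodeInstance G d).size : ℝ) ^ c ≤ 20 ^ (c₁ * c) * X ^ (2 * (c₁ * c)) := by
    have h : ((encodeInstance G d).size : ℝ) ≤ ((esize (n, φ.clauses) : ℝ) + 1) ^ c₁ := by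
      rw [hG]
      exact_mod_cast hc₁ (n, φ.clauses)
    have h' := h.trans (pow_le_pow_left₀ (by positivity) hsize _)
    refine (pow_le_pow_left₀ (by positivity) h' _).trans_eq ?_
    rw [← pow_mul, mul_pow, ← pow_mul]
  have hexp : (2 : ℝ) ^ f (treewidth G) ≤ (2 : ℝ) ^ (δ + C) * (2 : ℝ) ^ (δ * n) := by
    rw [← Real.rpow_add two_pos]
    refine Real.rpow_le_rpow_of_exponent_le one_le_two ((hfC _).trans ?_)
    have h : (treewidth G : ℝ) ^ 2 ≤ 201 ^ 2 * (4 * n + 4) := by exact_mod_cast htw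
    have h' := mul_le_mul_of_nonneg_left h (by positivity : 0 ≤ δ / (4 * 201 ^ 2))
    have e : δ / (4 * 201 ^ 2) * (201 ^ 2 * (4 * (n : ℝ) + 4)) = δ * n + δ := by ring
    linarith
  have h₂ : (t₂ : ℝ) ≤ |K| * ((2 : ℝ) ^ (δ + C) * (2 : ℝ) ^ (δ * n)) *
      (20 ^ (c₁ * c) * X ^ (2 * (c₁ * c))) := by
    refine ht₂.trans (mul_le_mul ?_ hsize₂ (by positivity) (by positivity))
    exact mul_le_mul (le_abs_self K) hexp (by positivity) (abs_nonneg K)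
  have hE : (1 : ℝ) ≤ (2 : ℝ) ^ (δ * n) := Real.one_le_rpow one_le_two (by positivity)
  have hp₁ : X ^ (2 * c₂) ≤ (2 : ℝ) ^ (δ * n) * X ^ (2 * c₂ + 2 * (c₁ * c)) :=
    (pow_le_pow_right₀ hX1 (Nat.le_add_right _ _)).trans
      (le_mul_of_one_le_left (by positivity) hE)
  have hp₂ : X ^ (2 * (c₁ * c)) ≤ X ^ (2 * c₂ + 2 * (c₁ * c)) :=
    pow_le_pow_right₀ hX1 (Nat.le_add_left _ _)
  rw [← hX, Nat.cast_add]
  have h₁' := h₁.trans (mul_le_mul_of_nonneg_left hp₁ (by positivity))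
  have h₂' := h₂.trans (mul_le_mul_of_nonneg_left
    (mul_le_mul_of_nonneg_left hp₂ (by positivity)) (by positivity))
  refine (add_le_add h₁' h₂').trans_eq ?_
  ring

end DenseSTM

/-- Unless the Exponential Time Hypothesis fails, no algorithm decides Dense 1-Shallow Topological
Minor in time `2^(o(t²)) N^O(1)`, where `t` is the treewidth of the input graph. -/
theorem mainTheorem3 :
    DenseSTM.ETH → ¬ ∃ p : DenseSTM.Prog, DenseSTM.DecidesDenseOneSTMSubexponentially p :=
  fun h ⟨p, hp⟩ => DenseSTM.not_decides_of_eth h p hp
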